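/- Let $W$ be a discrete memoryless channel with finite input alphabet $\mathcal X$ and finite output alphabet $\mathcal Y$, with transition probabilities $W(y|x)$. Assume that $W$ is symmetric in the sense of Gallager ($\mathcal Y$ can be partitioned so that, in the submatrix of transition probabilities of each part, every row is a permutation of every other row and every column is a permutation of every other column) and singular ($W(y|x)=W(y|z)$ whenever $W(y|x)W(y|z)>0$). For probability vectors $Q$ on $\mathcal X$, let $$E_{\mathrm{SP}}(R)=\max_{Q}\ \min_{V:\,I(Q;V)\le R} D(V\|W|Q)\in[0,\infty],$$ where $V$ ranges over the channels from $\mathcal X$ to $\mathcal Y$, $$E_{\mathrm r}(R)=\max_{Q}\max_{0\le\rho\le1}\Big\{-\ln\sum_{y}\Big(\sum_x Q(x)W(y|x)^{\frac1{1+\rho}}\Big)^{1+\rho}-\rho R\Big\},$$ and $C=\max_Q I(Q;W)$ (natural logarithms). Let $R_\infty$ be the largest rate such that $E_{\mathrm{SP}}=\infty$ at all nonnegative rates below it, and let $R_{\mathrm{cr}}\ge 0$ be the critical rate: for $R\ge0$, $E_{\mathrm r}(R)=E_{\mathrm{SP}}(R)$ if and only if $R\ge R_{\mathrm{cr}}$.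 An $(N,R)$ code has $\lceil e^{NR}\rceil$ messages and block length $N$; with ideal feedback, each channel input may depend on the message and on all previous channel outputs. Let $P_{\mathrm e}(N,R)$ be the least maximal error probability of an $(N,R)$ code without feedback, and $\bar P_{\mathrm{e,fb}}(N,R)$ the least average error probability of an $(N,R)$ code with ideal feedback. Assume $R_{\mathrm{cr}}<C$. (i) For every $R$ with $R_{\mathrm{cr}}<R<C$ there is a constant $K_2>0$, depending only on $W$ and $R$, such that for all $N\ge1$ $$P_{\mathrm e}(N,R)\le \frac{K_2}{\sqrt N}\,e^{-N E_{\mathrm r}(R)}.$$ (ii) For every $R$ with $R_\infty<R<C$, $E_{\mathrm{SP}}(R)$ is finite and there is a constant $\tilde K_2>0$, depending only on $W$ and $R$, such that for all $N\ge1$ $$\bar P_{\mathrm{e,fb}}(N,R)\ge \frac{\tilde K_2}{\sqrt N}\,e^{-N E_{\mathrm{SP}}(R)}.$$ Consequently, for $R_{\mathrm{cr}}<R<C$ one has $E_{\mathrm{SP}}(R)=E_{\mathrm r}(R)$, and both $P_{\mathrm e}(N,R)$ and $\bar P_{\mathrm{e,fb}}(N,R)$ are $\Theta\big(N^{-1/2}e^{-N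 E_{\mathrm r}(R)}\big)$ as $N\to\infty$. -/

import Mathlib

open scoped ENNReal

noncomputable section

namespace DMC

variable {X Y : Type*} [Fintype X] [Fintype Y]

/-- `W` is a discrete memoryless channel (a stochastic matrix) with input alphabet `X` and output
alphabet `Y`; `W x y` is the probability of receiving `y` when `x` is sent. -/
def IsChannel (W : X → Y → ℝ) : Prop :=
  ∀ x, W x ∈ stdSimplex ℝ Y

/-- Gallager's symmetry: the outputs can be partitioned (into the classes of `s`) so that in the
submatrix of each class every row is a permutation of every other row and every column is a
permutation of every other column. -/
def IsSymmetric (W : X → Y → ℝ) : Prop :=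
  ∃ s : Setoid Y, ∀ B ∈ s.classes,
    (∀ x x' : X, ∃ σ : Equiv.Perm B, ∀ y : B, W x' y = W x (σ y)) ∧
    (∀ y y' : B, ∃ τ : Equiv.Perm X, ∀ x : X, W x y' = W (τ x) y)

/-- Singularity of a (symmetric) channel. -/
def IsSingular (W : X → Y → ℝ) : Prop :=
  ∀ (x : X) (y : Y) (z : X), 0 < W x y * W z y → W x y = W z y

/-- The output distribution induced by the input distribution `Q`. -/
def outputDist (Q : X → ℝ) (V : X → Y → ℝ) (y : Y) : ℝ :=
  ∑ x, Q x * V x y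

/-- Mutual information `I(Q;V)` in nats. Terms with `Q x = 0` or `V x y = 0` vanish; in all others
the argument of the logarithm is positive. -/
def mutualInfo (Q : X → ℝ) (V : X → Y → ℝ) : ℝ :=
  ∑ x, ∑ y, Q x * V x y * Real.log (V x y / outputDist Q V y)

/-- The capacity `C(W) = max_Q I(Q;W)`. -/
def capacity (W : X → Y → ℝ) : ℝ :=
  ⨆ Q : stdSimplex ℝ X, mutualInfo (Q : X → ℝ) W

open Classical in
/-- Relative entropy `D(p‖q)` of distributions on a finite set; infinite unless `p ≪ q`. -/
def relEntropy (p q : Y → ℝ) : ℝ≥0∞ :=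
  if ∀ y, q y = 0 → p y = 0 then ENNReal.ofReal (∑ y, p y * Real.log (p y / q y)) else ⊤

/-- Conditional relative entropy `D(V‖W|Q)`, with the convention `0 * ∞ = 0`. -/
def condRelEntropy (V W : X → Y → ℝ) (Q : X → ℝ) : ℝ≥0∞ :=
  ∑ x, ENNReal.ofReal (Q x) * relEntropy (V x) (W x)

/-- `E_SP(R,Q)`: the minimum of `D(V‖W|Q)` over the channels `V` with `I(Q;V) ≤ R`. -/
def spherePackingExponentAt (W : X → Y → ℝ) (R : ℝ) (Q : X → ℝ) : ℝ≥0∞ :=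
  ⨅ (V : X → Y → ℝ) (_ : IsChannel V) (_ : mutualInfo Q V ≤ R), condRelEntropy V W Q

/-- The sphere-packing exponent `E_SP(R) = max_Q E_SP(R,Q)`, possibly infinite. -/
def spherePackingExponent (W : X → Y → ℝ) (R : ℝ) : ℝ≥0∞ :=
  ⨆ Q : stdSimplex ℝ X, spherePackingExponentAt W R (Q : X → ℝ)

/-- Gallager's function `E_o(ρ,Q)`. -/
def gallagerE0 (W : X → Y → ℝ) (ρ : ℝ) (Q : X → ℝ) : ℝ :=
  -Real.log (∑ y, (∑ x, Q x * W x y ^ (1 / (1 + ρ))) ^ (1 + ρ))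

/-- `E_r(R,Q) = max_{0 ≤ ρ ≤ 1} (E_o(ρ,Q) - ρ R)`. -/
def randomCodingExponentAt (W : X → Y → ℝ) (R : ℝ) (Q : X → ℝ) : ℝ :=
  ⨆ ρ : Set.Icc (0 : ℝ) 1, (gallagerE0 W ρ Q - ρ * R)

/-- The random coding exponent `E_r(R) = max_Q E_r(R,Q)` (nonnegative, as `ρ = 0` shows). -/
def randomCodingExponent (W : X → Y → ℝ) (R : ℝ) : ℝ :=
  ⨆ Q : stdSimplex ℝ X, randomCodingExponentAt W R (Q : X → ℝ)

/-- `R_∞`: the largest rate such that `E_SP` is infinite at all (nonnegative) rates below it. -/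
def rateInfty (W : X → Y → ℝ) : ℝ :=
  sSup {r : ℝ | 0 ≤ r ∧ ∀ R, 0 ≤ R → R < r → spherePackingExponent W R = ⊤}

/-- The critical rate `R_cr`: the threshold on the nonnegative rates from which on `E_r` and `E_SP`
coincide. -/
def criticalRate (W : X → Y → ℝ) : ℝ :=
  sInf {r : ℝ | 0 ≤ r ∧
    ∀ R, r ≤ R → ENNReal.ofReal (randomCodingExponent W R) = spherePackingExponent W R}

/-- The number of messages `⌈e^{NR}⌉` of an `(N,R)` code. -/
def numMessages (N : ℕ) (R : ℝ) : ℕ :=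
  ⌈Real.exp (N * R)⌉₊

variable (X Y) in
/-- An `(N,R)` code without feedback. -/
structure Code (N : ℕ) (R : ℝ) where
  enc : Fin (numMessages N R) → Fin N → X
  dec : (Fin N → Y) → Fin (numMessages N R)

variable (X Y) in
/-- An `(N,R)` code with ideal feedback: `enc m n` maps the channel outputs received before
time `n` (times are `0, …, N-1`) to the channel input at time `n`. -/
structure FeedbackCode (N : ℕ) (R : ℝ) where
  enc : Fin (numMessages N R) → (n : Fin N) → (Fin n → Y) → X
  dec : (Fin N → Y) → Fin (numMessages N R)

open Classical in
/-- The error probability of a code without feedback when message `m` is sent. -/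
def Code.errorProb {N : ℕ} {R : ℝ} (W : X → Y → ℝ) (c : Code X Y N R)
    (m : Fin (numMessages N R)) : ℝ :=
  ∑ y : Fin N → Y with c.dec y ≠ m, ∏ n, W (c.enc m n) (y n)

/-- The maximal error probability of a code without feedback. -/
def Code.maxError {N : ℕ} {R : ℝ} (W : X → Y → ℝ) (c : Code X Y N R) : ℝ :=
  ⨆ m, c.errorProb W m

open Classical in
/-- The error probability of a feedback code when message `m` is sent. -/
def FeedbackCode.errorProb {N : ℕ} {R : ℝ} (W : X → Y → ℝ) (c : FeedbackCode X Y N R)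
    (m : Fin (numMessages N R)) : ℝ :=
  ∑ y : Fin N → Y with c.dec y ≠ m,
    ∏ n : Fin N, W (c.enc m n fun i => y (Fin.castLE n.isLt.le i)) (y n)

/-- The average error probability of a feedback code. -/
def FeedbackCode.avgError {N : ℕ} {R : ℝ} (W : X → Y → ℝ) (c : FeedbackCode X Y N R) : ℝ :=
  (∑ m, c.errorProb W m) / numMessages N R

/-- `P_e(N,R)`: the least maximal error probability of an `(N,R)` code without feedback. -/
def minMaxError (W : X → Y → ℝ) (N : ℕ) (R : ℝ) : ℝ :=
  ⨅ c : Code X Y N R, c.maxError W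

/-- The least average error probability of an `(N,R)` code with ideal feedback. -/
def minAvgErrorFeedback (W : X → Y → ℝ) (N : ℕ) (R : ℝ) : ℝ :=
  ⨅ c : FeedbackCode X Y N R, c.avgError W

end DMC

end

/-! ### Local limit estimates of order 1/√N for sums of i.i.d. finite-valued letters. -/

namespace LocalLimit

/-! ### Binomial coefficients near the centre -/

/-! Singularity says that `W x y` is either 0 or a number δ(y) (`columnValue`) not depending on x.
Let β(y) (`supportFrac`) be the fraction of inputs that can lead to y. Uniform inputs then produce
the output law q = δβ, and symmetry makes the law of β(y) under `W x` the same for every x, hence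
equal to its law under q. This invariance survives feedback (`sum_feedbackProb_mul`), so for every
encoder S = ∑ (J(yₙ) − R), with J = −log β, behaves as an i.i.d. sum under q.

Converse (`seqExp_le_avgError`): at an output sequence the decoder can save only one message, worth
at most ∏ δ, while functions of ∏ β see a total mass M ∏ δβ. Hence the error is at least E(1 −
e^S)⁺. Achievability (`exists_codebook`, `exists_code_maxError_le`): codewords are picked greedily
and the first compatible one is decoded; the union bound truncated at one gives at most 2 E min(1,
e^{−S}).

Both expectations are evaluated by tilting. Let λ(ρ) = E_q e^{−ρ(J−R)}. At a minimiser ρ > 0 the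
tilted law is centred, and a factor λ(ρ)^N comes out (`seqExp_eq_tilt`). For the upper bound, 0 < ρ
< 1 makes the remaining integrand decay exponentially on both sides of 0; for the lower bound it is
bounded below on a window near 0. Either way the remaining factor has order 1/√N. To avoid a
lattice/non-lattice distinction, a fair coin between two letters is split off the tilted law
(`seqExp_eq_split`): given everything else the sum runs over an arithmetic progression with binomial
weights.

Only one-sided estimates of the exponents are needed: E_o(ρ,Q) ≤ −log E_q e^{−ρJ} for all Q
(`gallagerE0_le`), and E_SP(R) ≥ −log λ(ρ) for all ρ ≥ 0 (`ofReal_le_spherePackingExponent`). If E_r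
and E_SP agree at R, a minimiser of λ on [0,1] is therefore a minimiser on [0,∞). Comparison with a
smaller rate where they still agree gives ρ < 1 strictly (`saddle_lt`). -/

theorem centralBinom_sq_mul_le (n : ℕ) :
    (n.centralBinom : ℝ) ^ 2 * (2 * n + 1) ≤ 16 ^ n := by
  induction n with
  | zero => simp
  | succ n ih =>
    have h : ((n : ℝ) + 1) * (n + 1).centralBinom = 2 * (2 * n + 1) * n.centralBinom := by
      exact_mod_cast Nat.succ_mul_centralBinom_succ n
    have hn : (0 : ℝ) < (n + 1) ^ 2 := by positivity
    refine le_of_mul_le_mul_left ?_ hn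
    calc ((n : ℝ) + 1) ^ 2 * (((n + 1).centralBinom : ℝ) ^ 2 * (2 * (n + 1 : ℕ) + 1))
        = (((n : ℝ) + 1) * (n + 1).centralBinom) ^ 2 * (2 * n + 3) := by push_cast; ring
      _ = (4 * ((2 * n + 1) * (2 * n + 3))) * ((n.centralBinom : ℝ) ^ 2 * (2 * n + 1)) := by
        rw [h]; ring
      _ ≤ (4 * (4 * (n + 1) ^ 2)) * 16 ^ n :=
        mul_le_mul (by nlinarith) ih (by positivity) (by positivity)
      _ = ((n : ℝ) + 1) ^ 2 * 16 ^ (n + 1) := by ring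

theorem le_centralBinom_sq_mul (n : ℕ) :
    (16 : ℝ) ^ n ≤ (n.centralBinom : ℝ) ^ 2 * (4 * n + 1) := by
  induction n with
  | zero => simp
  | succ n ih =>
    have h : ((n : ℝ) + 1) * (n + 1).centralBinom = 2 * (2 * n + 1) * n.centralBinom := by
      exact_mod_cast Nat.succ_mul_centralBinom_succ n
    have hn : (0 : ℝ) < (n + 1) ^ 2 := by positivity
    refine le_of_mul_le_mul_left ?_ hn
    calc ((n : ℝ) + 1) ^ 2 * 16 ^ (n + 1) = 16 * (n + 1) ^ 2 * 16 ^ n := by ring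
      _ ≤ 16 * (n + 1) ^ 2 * ((n.centralBinom : ℝ) ^ 2 * (4 * n + 1)) := by gcongr
      _ = (16 * (n + 1) ^ 2 * (4 * n + 1)) * (n.centralBinom : ℝ) ^ 2 := by ring
      -- After removal of the common factor 4 the two cubics in n differ by exactly 1.
      _ ≤ (4 * (2 * n + 1) ^ 2 * (4 * n + 5)) * (n.centralBinom : ℝ) ^ 2 := by
        gcongr ?_ * _
        nlinarith [sq_nonneg (n : ℝ), (Nat.cast_nonneg n : (0 : ℝ) ≤ n)]
      _ = (((n : ℝ) + 1) * (n + 1).centralBinom) ^ 2 * (4 * n + 5) := by rw [h]; ring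
      _ = _ := by push_cast; ring

theorem two_mul_choose_odd (n : ℕ) :
    2 * (2 * n + 1).choose n = (n + 1).centralBinom := by
  rw [Nat.centralBinom_eq_two_mul_choose, show 2 * (n + 1) = (2 * n + 1) + 1 by ring,
    Nat.choose_succ_succ, Nat.choose_symm_half]
  ring

theorem choose_sq_mul_le (m i : ℕ) :
    (m.choose i : ℝ) ^ 2 * (m + 1) ≤ 4 ^ m := by
  have hmid : (m.choose i : ℝ) ≤ m.choose (m / 2) := by exact_mod_cast Nat.choose_le_middle i m
  refine le_trans (b := (m.choose (m / 2) : ℝ) ^ 2 * (m + 1)) (by gcongr) ?_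
  obtain ⟨n, rfl | rfl⟩ := Nat.even_or_odd' m
  · rw [Nat.mul_div_cancel_left _ two_pos, ← Nat.centralBinom_eq_two_mul_choose, pow_mul]
    norm_num
    exact_mod_cast centralBinom_sq_mul_le n
  · have h1 : (2 * n + 1) / 2 = n := by omega
    have h2 : (2 : ℝ) * ((2 * n + 1).choose n : ℕ) = ((n + 1).centralBinom : ℕ) := by
      exact_mod_cast two_mul_choose_odd n
    have h3 := centralBinom_sq_mul_le (n + 1)
    rw [← h2] at h3
    rw [h1, pow_succ (4 : ℝ), pow_mul (4 : ℝ)]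
    push_cast at h3 ⊢
    rw [pow_succ (16 : ℝ)] at h3
    norm_num
    nlinarith [sq_nonneg (((2 * n + 1).choose n : ℕ) : ℝ)]

theorem choose_middle_sq_mul_ge (m : ℕ) :
    (4 : ℝ) ^ m ≤ (m.choose (m / 2) : ℝ) ^ 2 * (2 * m + 3) := by
  obtain ⟨n, rfl | rfl⟩ := Nat.even_or_odd' m
  · rw [Nat.mul_div_cancel_left _ two_pos, ← Nat.centralBinom_eq_two_mul_choose, pow_mul]
    have := le_centralBinom_sq_mul n
    push_cast
    norm_num
    nlinarith [sq_nonneg (n.centralBinom : ℝ)]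
  · have h1 : (2 * n + 1) / 2 = n := by omega
    have h2 : (2 : ℝ) * ((2 * n + 1).choose n : ℕ) = ((n + 1).centralBinom : ℕ) := by
      exact_mod_cast two_mul_choose_odd n
    have h3 := le_centralBinom_sq_mul (n + 1)
    rw [← h2] at h3
    rw [h1, pow_succ (4 : ℝ), pow_mul (4 : ℝ)]
    push_cast at h3 ⊢
    rw [pow_succ (16 : ℝ)] at h3
    norm_num
    nlinarith [sq_nonneg (((2 * n + 1).choose n : ℕ) : ℝ)]

theorem choose_div_two_pow_le (m i : ℕ) :
    (m.choose i : ℝ) / 2 ^ m ≤ 1 / Real.sqrt (m + 1) := by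
  have h := choose_sq_mul_le m i
  have hs : (0 : ℝ) < m + 1 := by positivity
  rw [div_le_div_iff₀ (by positivity) (Real.sqrt_pos.2 hs), one_mul]
  refine (abs_le_of_sq_le_sq' ?_ (by positivity)).2
  rw [mul_pow, Real.sq_sqrt hs.le, ← pow_mul, mul_comm m 2, pow_mul]
  norm_num
  exact h

theorem choose_middle_div_two_pow_ge (m : ℕ) :
    1 / Real.sqrt (2 * m + 3) ≤ (m.choose (m / 2) : ℝ) / 2 ^ m := by
  have h := choose_middle_sq_mul_ge m
  have hs : (0 : ℝ) < 2 * m + 3 := by positivity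
  rw [div_le_div_iff₀ (Real.sqrt_pos.2 hs) (by positivity), one_mul]
  refine (abs_le_of_sq_le_sq' ?_ (by positivity)).2
  rw [mul_pow, Real.sq_sqrt hs.le, ← pow_mul, mul_comm m 2, pow_mul]
  norm_num
  exact h

/-- Moving `k` steps up from the middle multiplies a binomial coefficient by at least `x ^ k`,
when `x` is a lower bound for the last ratio. -/
theorem choose_middle_add_ge (m k : ℕ) (x : ℝ) (hx : 0 ≤ x)
    (h : x * (m / 2 + k + 1) ≤ m / 2 - k) :
    x ^ k * m.choose (m / 2) ≤ m.choose (m / 2 + k) := by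
  induction k with
  | zero => simp
  | succ k ih =>
    have ih' := ih (by push_cast at h; nlinarith)
    have hle : m / 2 + k ≤ m := by
      have h0 : (0 : ℝ) ≤ m / 2 - (k + 1 : ℕ) := le_trans (by positivity) h
      have : ((2 * k + 2 : ℕ) : ℝ) ≤ m := by push_cast at h0 ⊢; linarith
      have : 2 * k + 2 ≤ m := by exact_mod_cast this
      omega
    have hrec : (m.choose (m / 2 + k + 1) : ℝ) * ((m / 2 : ℕ) + k + 1)
        = m.choose (m / 2 + k) * (m - ((m / 2 : ℕ) + k)) := by
      have := Nat.choose_succ_right_eq m (m / 2 + k)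
      have h2 : ((m.choose (m / 2 + k + 1) * (m / 2 + k + 1) : ℕ) : ℝ)
        = ((m.choose (m / 2 + k) * (m - (m / 2 + k)) : ℕ) : ℝ) := by exact_mod_cast this
      push_cast [Nat.cast_sub hle] at h2
      exact h2
    have hf : ((m / 2 : ℕ) : ℝ) ≤ m / 2 := Nat.cast_div_le
    have hpos : (0 : ℝ) < (m / 2 : ℕ) + k + 1 := by positivity
    have hr : x * ((m / 2 : ℕ) + k + 1) ≤ m - ((m / 2 : ℕ) + k) := by
      push_cast at h
      nlinarith
    rw [← add_assoc, pow_succ]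
    refine le_of_mul_le_mul_right ?_ hpos
    rw [hrec]
    calc x ^ k * x * (m.choose (m / 2)) * ((m / 2 : ℕ) + k + 1)
        = (x ^ k * m.choose (m / 2)) * (x * ((m / 2 : ℕ) + k + 1)) := by ring
      _ ≤ _ := by gcongr

/-- Since e^{2x} ≥ 1 + 2x and (1 + 2x)(1 − x) ≥ 1 on this range. It turns the product of ratios (1 −
z)^k into an exponential. -/
theorem exp_neg_two_mul_le {x : ℝ} (h0 : 0 ≤ x) (h1 : x ≤ 1 / 2) :
    Real.exp (-(2 * x)) ≤ 1 - x := by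
  rw [Real.exp_neg]
  refine inv_le_of_inv_le₀ (by linarith) ?_
  have h := Real.add_one_le_exp (2 * x)
  refine le_trans ?_ h
  rw [inv_le_iff_one_le_mul₀ (by linarith)]
  nlinarith

/-- A binomial coefficient at distance at most `r` from the centre, where `r ^ 2` is of the
order of `m`. -/
theorem choose_div_two_pow_ge (m i : ℕ) (r : ℝ) (hr : 1 ≤ r) (hm : 20 * r ≤ m)
    (h1 : (m : ℝ) / 2 - r ≤ i) (h2 : (i : ℝ) ≤ m / 2 + r) :
    Real.exp (-(40 * r ^ 2 / m)) / Real.sqrt (2 * m + 3) ≤ (m.choose i : ℝ) / 2 ^ m := by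
  wlog hi : m / 2 ≤ i generalizing i
  · have him : i ≤ m := by omega
    have hc : ((m - i : ℕ) : ℝ) = m - i := Nat.cast_sub him
    have := this (m - i) (by rw [hc]; linarith) (by rw [hc]; linarith) (by omega)
    rwa [Nat.choose_symm him] at this
  have hm0 : (0 : ℝ) < m := by linarith
  obtain ⟨k, rfl⟩ := Nat.exists_eq_add_of_le hi
  have hk : (k : ℝ) ≤ r + 1 := by
    push_cast at h2
    have : (m : ℝ) / 2 ≤ (m / 2 : ℕ) + 1 := by
      have h : m ≤ 2 * (m / 2) + 2 := by omega
      have : (m : ℝ) ≤ 2 * (m / 2 : ℕ) + 2 := by exact_mod_cast h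
      linarith
    linarith
  -- A ratio of neighbouring coefficients is at least 1 − z once 2k + 1 ≤ z(m/2 + k + 1). Here z m/2
  -- = 5r, and 2k + 1 ≤ 2r + 3 ≤ 5r because r ≥ 1.
  set z : ℝ := (10 * r) / m with hz
  have hzm : z * m = 10 * r := by rw [hz]; field_simp
  have hz0 : 0 ≤ z := by positivity
  have hz1 : z ≤ 1 / 2 := by rw [hz, div_le_iff₀ hm0]; linarith
  have key := choose_middle_add_ge m k (1 - z) (by linarith) (by
    have : 0 ≤ z * (k : ℝ) := by positivity
    nlinarith)
  have hexp : Real.exp (-(40 * r ^ 2 / m)) ≤ (1 - z) ^ k := by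
    calc Real.exp (-(40 * r ^ 2 / m)) ≤ Real.exp (k * -(2 * z)) := by
          refine Real.exp_le_exp.2 ?_
          have h40 : 40 * r ^ 2 / m = 4 * r * z := by rw [hz]; ring
          rw [h40]
          nlinarith
      _ = Real.exp (-(2 * z)) ^ k := Real.exp_nat_mul _ _
      _ ≤ (1 - z) ^ k := pow_le_pow_left₀ (Real.exp_pos _).le (exp_neg_two_mul_le hz0 hz1) k
  have hmid := choose_middle_div_two_pow_ge m
  have h1z : 0 ≤ (1 - z) ^ k := pow_nonneg (by linarith) k
  calc Real.exp (-(40 * r ^ 2 / m)) / Real.sqrt (2 * m + 3)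
      = Real.exp (-(40 * r ^ 2 / m)) * (1 / Real.sqrt (2 * m + 3)) := by ring
    _ ≤ (1 - z) ^ k * ((m.choose (m / 2) : ℝ) / 2 ^ m) := by
        gcongr
    _ = ((1 - z) ^ k * m.choose (m / 2)) / 2 ^ m := by ring
    _ ≤ _ := by gcongr

/-! ### Expectations over i.i.d. sequences in a finite alphabet -/

/-- The expectation of `F` over sequences of `N` independent letters with weights `p`. -/
noncomputable def seqExp {Ω : Type*} [Fintype Ω] (p : Ω → ℝ) (N : ℕ) (F : (Fin N → Ω) → ℝ) : ℝ :=
  ∑ ω : Fin N → Ω, (∏ i, p (ω i)) * F ω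

section SeqExp

variable {Ω : Type*} [Fintype Ω] {p : Ω → ℝ} {N : ℕ}

theorem seqExp_zero (F : (Fin 0 → Ω) → ℝ) : seqExp p 0 F = F Fin.elim0 := by
  simp only [seqExp, Finset.univ_eq_empty, Finset.prod_empty, one_mul]
  rw [Fintype.sum_unique]
  congr 1

theorem seqExp_succ (F : (Fin (N + 1) → Ω) → ℝ) :
    seqExp p (N + 1) F = ∑ a, p a * seqExp p N fun ω => F (Fin.cons a ω) := by
  unfold seqExp
  rw [← (Fin.consEquiv fun _ : Fin (N + 1) => Ω).sum_comp, Fintype.sum_prod_type]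
  refine Finset.sum_congr rfl fun a _ => ?_
  rw [Finset.mul_sum]
  refine Finset.sum_congr rfl fun ω _ => ?_
  simp [Fin.consEquiv, Fin.prod_univ_succ, mul_assoc]

theorem seqExp_mono (hp : ∀ a, 0 ≤ p a) {F G : (Fin N → Ω) → ℝ} (h : ∀ ω, F ω ≤ G ω) :
    seqExp p N F ≤ seqExp p N G :=
  Finset.sum_le_sum fun ω _ =>
    mul_le_mul_of_nonneg_left (h ω) (Finset.prod_nonneg fun _ _ => hp _)

theorem seqExp_add (F G : (Fin N → Ω) → ℝ) :
    seqExp p N (fun ω => F ω + G ω) = seqExp p N F + seqExp p N G := by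
  simp only [seqExp, mul_add, Finset.sum_add_distrib]

theorem seqExp_const_mul (c : ℝ) (F : (Fin N → Ω) → ℝ) :
    seqExp p N (fun ω => c * F ω) = c * seqExp p N F := by
  simp only [seqExp, Finset.mul_sum]
  exact Finset.sum_congr rfl fun ω _ => by ring

theorem seqExp_const (hp : ∑ a, p a = 1) (c : ℝ) : seqExp p N (fun _ => c) = c := by
  induction N with
  | zero => exact seqExp_zero _
  | succ N ih => rw [seqExp_succ, ih, ← Finset.sum_mul, hp, one_mul]

theorem seqExp_sum (hp : ∑ a, p a = 1) (f : Ω → ℝ) (hf : ∑ a, p a * f a = 0) :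
    seqExp p N (fun ω => ∑ i, f (ω i)) = 0 := by
  induction N with
  | zero => simp [seqExp_zero]
  | succ N ih =>
    simp only [seqExp_succ, Fin.sum_univ_succ, Fin.cons_zero, Fin.cons_succ, seqExp_add, ih,
      seqExp_const hp, add_zero, hf]

theorem seqExp_sum_sq (hp : ∑ a, p a = 1) (f : Ω → ℝ) (hf : ∑ a, p a * f a = 0) :
    seqExp p N (fun ω => (∑ i, f (ω i)) ^ 2) = N * ∑ a, p a * f a ^ 2 := by
  induction N with
  | zero => simp [seqExp_zero]
  | succ N ih =>
    rw [seqExp_succ]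
    have : ∀ a, seqExp p N (fun ω => (∑ i, f ((Fin.cons a ω : Fin (N + 1) → Ω) i)) ^ 2)
        = f a ^ 2 + N * ∑ a, p a * f a ^ 2 := by
      intro a
      have h : ∀ ω : Fin N → Ω, (∑ i, f ((Fin.cons a ω : Fin (N + 1) → Ω) i)) ^ 2
          = f a ^ 2 + (2 * f a * (∑ i, f (ω i)) + (∑ i, f (ω i)) ^ 2) := by
        intro ω
        rw [Fin.sum_univ_succ]
        simp only [Fin.cons_zero, Fin.cons_succ]
        ring
      simp only [h]
      rw [seqExp_add, seqExp_const hp, seqExp_add, seqExp_const_mul, seqExp_sum hp f hf, ih]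
      ring
    simp only [this, mul_add, Finset.sum_add_distrib]
    rw [← Finset.sum_mul, hp]
    push_cast
    ring

end SeqExp

/-! ### Splitting off a fair coin -/

/-- Average of `g` over the end points of `m` fair steps in `{a₁, a₂}` from `s`. -/
noncomputable def coinAvg (a₁ a₂ : ℝ) (m : ℕ) (g : ℝ → ℝ) (s : ℝ) : ℝ :=
  ∑ i ∈ Finset.range (m + 1), (m.choose i : ℝ) / 2 ^ m * g (s + m * a₁ + i * (a₂ - a₁))

theorem coinAvg_zero (a₁ a₂ : ℝ) (g : ℝ → ℝ) (s : ℝ) : coinAvg a₁ a₂ 0 g s = g s := by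
  simp [coinAvg]

theorem coinAvg_shift (a₁ a₂ : ℝ) (m : ℕ) (g : ℝ → ℝ) (s a : ℝ) :
    coinAvg a₁ a₂ m (fun s => g (s + a)) s = coinAvg a₁ a₂ m g (a + s) := by
  unfold coinAvg
  refine Finset.sum_congr rfl fun i _ => ?_
  dsimp only
  rw [show s + m * a₁ + i * (a₂ - a₁) + a = a + s + m * a₁ + i * (a₂ - a₁) by ring]

/-- Pascal's rule, read as one further fair step. -/
theorem coinAvg_succ (a₁ a₂ : ℝ) (m : ℕ) (g : ℝ → ℝ) (s : ℝ) :
    coinAvg a₁ a₂ m (fun s => (g (s + a₁) + g (s + a₂)) / 2) s = coinAvg a₁ a₂ (m + 1) g s := by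
  unfold coinAvg
  rw [Finset.sum_range_succ' _ (m + 1)]
  simp only [Nat.choose_succ_succ, Nat.cast_add, add_div, add_mul, Finset.sum_add_distrib]
  set A : ℕ → ℝ := fun i => g (s + (m + 1) * a₁ + i * (a₂ - a₁)) with hA
  have e1 : ∀ i : ℕ, g (s + m * a₁ + i * (a₂ - a₁) + a₁) = A i := fun i => by
    rw [hA]; dsimp only; congr 1; ring
  have e2 : ∀ i : ℕ, g (s + m * a₁ + i * (a₂ - a₁) + a₂) = A (i + 1) := fun i => by
    rw [hA]; dsimp only; congr 1; push_cast; ring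
  simp only [e1, e2, mul_add, Finset.sum_add_distrib]
  have e3 : ∀ i : ℕ, g (s + ((m : ℝ) * a₁ + ((1 : ℕ) : ℝ) * a₁)
      + ((i : ℝ) * (a₂ - a₁) + ((1 : ℕ) : ℝ) * (a₂ - a₁))) = A (i + 1) := fun i => by
    rw [hA]; dsimp only; congr 1; push_cast; ring
  have e4 : g (s + ((m : ℝ) * a₁ + ((1 : ℕ) : ℝ) * a₁) + ((0 : ℕ) : ℝ) * (a₂ - a₁)) = A 0 := by
    rw [hA]; dsimp only; congr 1; push_cast; ring
  simp only [e3, e4]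
  have e5 := Finset.sum_range_succ' (fun i => (m.choose i : ℝ) / 2 ^ (m + 1) * A i) (m + 1)
  rw [Finset.sum_range_succ] at e5
  simp only [Nat.choose_succ_self, Nat.cast_zero, zero_div, zero_mul, add_zero] at e5
  simp only [Nat.choose_zero_right] at e5 ⊢
  have e6 : ∀ F : ℕ → ℝ, ∑ x ∈ Finset.range (m + 1), (m.choose x : ℝ) / 2 ^ m * (F x / 2)
      = ∑ x ∈ Finset.range (m + 1), (m.choose x : ℝ) / 2 ^ (m + 1) * F x := fun F =>
    Finset.sum_congr rfl fun x _ => by rw [pow_succ]; field_simp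
  rw [e6 A, e6 fun x => A (x + 1), e5]
  simp only [Nat.succ_eq_add_one]
  ring

section Mixture

variable {Ω : Type*}

open Classical in
/-- The weights left after an event of probability `2 * ε` (`none`), in which the letter is one of
`y₁`, `y₂` with equal chances, has been split off. -/
noncomputable def splitWeight (p : Ω → ℝ) (y₁ y₂ : Ω) (ε : ℝ) : Option Ω → ℝ
  | none => 2 * ε
  | some ω => p ω - (if ω = y₁ then ε else 0) - (if ω = y₂ then ε else 0)

/-- The number of coins, zero or one, used by a letter. -/
def coinCount : Option Ω → ℕ
  | none => 1
  | some _ => 0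

theorem sum_splitWeight_mul [Fintype Ω] (p : Ω → ℝ) (y₁ y₂ : Ω) (ε : ℝ) (F : Option Ω → ℝ) :
    ∑ o, splitWeight p y₁ y₂ ε o * F o
      = 2 * ε * F none - ε * F (some y₁) - ε * F (some y₂) + ∑ ω, p ω * F (some ω) := by
  classical
  rw [Fintype.sum_option]
  simp only [splitWeight, sub_mul, Finset.sum_sub_distrib, ite_mul, zero_mul,
    Finset.sum_ite_eq', Finset.mem_univ, if_true]
  ring

theorem splitWeight_nonneg {p : Ω → ℝ} {y₁ y₂ : Ω} {ε : ℝ} (hp : ∀ ω, 0 ≤ p ω) (hε : 0 ≤ ε)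
    (h₁ : ε ≤ p y₁) (h₂ : ε ≤ p y₂) (hne : y₁ ≠ y₂) (o : Option Ω) :
    0 ≤ splitWeight p y₁ y₂ ε o := by
  classical
  cases o with
  | none => simp only [splitWeight]; positivity
  | some ω =>
    simp only [splitWeight]
    split_ifs with h h' h'
    · exact absurd (h.symm.trans h') hne
    · subst h; linarith
    · subst h'; linarith
    · have := hp ω; linarith

/-- The law p is a mixture: with weight 2ε a fair choice between y₁ and y₂, otherwise the remainder.
All the coins are averaged last. The induction needs every g, because the first letter translates g.
The identity is purely algebraic, so no sign condition on the weights enters. -/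
theorem seqExp_eq_split [Fintype Ω] (p a : Ω → ℝ) (y₁ y₂ : Ω) (ε : ℝ) (N : ℕ) (g : ℝ → ℝ) :
    seqExp p N (fun ω => g (∑ i, a (ω i)))
      = seqExp (splitWeight p y₁ y₂ ε) N fun o =>
          coinAvg (a y₁) (a y₂) (∑ i, coinCount (o i)) g (∑ i, (o i).elim 0 a) := by
  induction N generalizing g with
  | zero => simp [seqExp_zero, coinAvg_zero]
  | succ N ih =>
    rw [seqExp_succ, seqExp_succ, sum_splitWeight_mul]
    have hc0 : coinCount (none : Option Ω) = 1 := rfl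
    have hc1 : ∀ ω : Ω, coinCount (some ω) = 0 := fun _ => rfl
    simp only [Fin.sum_univ_succ, Fin.cons_zero, Fin.cons_succ, hc0, hc1, Option.elim_none,
      Option.elim_some, zero_add]
    have hs : ∀ ω, seqExp p N (fun o => g (a ω + ∑ i, a (o i)))
        = seqExp (splitWeight p y₁ y₂ ε) N fun o =>
          coinAvg (a y₁) (a y₂) (∑ i, coinCount (o i)) g (a ω + ∑ i, (o i).elim 0 a) := by
      intro ω
      simp only [← coinAvg_shift]
      rw [← ih fun s => g (s + a ω)]
      simp only [add_comm]
    have hn : seqExp (splitWeight p y₁ y₂ ε) N (fun o =>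
          coinAvg (a y₁) (a y₂) (1 + ∑ i, coinCount (o i)) g (∑ i, (o i).elim 0 a))
        = (seqExp p N (fun o => g (a y₁ + ∑ i, a (o i)))
            + seqExp p N (fun o => g (a y₂ + ∑ i, a (o i)))) / 2 := by
      simp only [add_comm 1, ← coinAvg_succ]
      rw [← ih fun s => (g (s + a y₁) + g (s + a y₂)) / 2, div_eq_inv_mul, ← seqExp_add,
        ← seqExp_const_mul]
      simp only [div_eq_inv_mul, add_comm]
    rw [hn, ← hs y₁, ← hs y₂]
    simp only [← hs]
    ring

theorem sum_coinCount_le {N : ℕ} (o : Fin N → Option Ω) : ∑ i, coinCount (o i) ≤ N := by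
  calc ∑ i, coinCount (o i) ≤ ∑ _i : Fin N, 1 :=
        Finset.sum_le_sum fun i _ => by cases o i <;> simp [coinCount]
    _ = N := by simp

end Mixture

/-! ### Exponentially decaying functions along arithmetic progressions -/

/-- A bounded monotone function whose increments dominate `exp (-κ |u|)`. -/
noncomputable def decayPrimitive (κ u : ℝ) : ℝ :=
  if u ≤ 0 then Real.exp (κ * u) else 2 - Real.exp (-(κ * u))

theorem decayPrimitive_nonneg {κ : ℝ} (hκ : 0 < κ) (u : ℝ) : 0 ≤ decayPrimitive κ u := by
  unfold decayPrimitive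
  split_ifs with h
  · positivity
  · have : Real.exp (-(κ * u)) ≤ 1 := Real.exp_le_one_iff.2 (by nlinarith)
    linarith

theorem decayPrimitive_le_two {κ : ℝ} (hκ : 0 < κ) (u : ℝ) : decayPrimitive κ u ≤ 2 := by
  unfold decayPrimitive
  split_ifs with h
  · have : Real.exp (κ * u) ≤ 1 := Real.exp_le_one_iff.2 (by nlinarith)
    linarith
  · have := Real.exp_pos (-(κ * u))
    linarith

/-- The half step d/2 in the constant comes from the case where [u, u + d] straddles 0: one of its
ends then lies at distance at least d/2 from 0. -/
theorem decayPrimitive_increment {κ d : ℝ} (hκ : 0 < κ) (hd : 0 < d) (u : ℝ) :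
    (1 - Real.exp (-(κ * d / 2))) * Real.exp (-(κ * |u|))
      ≤ decayPrimitive κ (u + d) - decayPrimitive κ u := by
  have hκd : 0 < κ * d := by positivity
  have hhalf : Real.exp (-(κ * d)) ≤ Real.exp (-(κ * d / 2)) := Real.exp_le_exp.2 (by linarith)
  have hlt : Real.exp (-(κ * d / 2)) < 1 := Real.exp_lt_one_iff.2 (by linarith)
  unfold decayPrimitive
  split_ifs with h1 h2 h2
  · rw [abs_of_nonpos h2, show -(κ * -u) = κ * u by ring, mul_add, Real.exp_add]
    have h : 1 + κ * d ≤ Real.exp (κ * d) := by linarith [Real.add_one_le_exp (κ * d)]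
    have h' : 1 - κ * d / 2 ≤ Real.exp (-(κ * d / 2)) := by
      linarith [Real.add_one_le_exp (-(κ * d / 2))]
    nlinarith [Real.exp_pos (κ * u)]
  · exact absurd (by linarith) h2
  · push Not at h1
    have hu : Real.exp (κ * u) ≤ 1 := Real.exp_le_one_iff.2 (by nlinarith)
    have hv : Real.exp (-(κ * (u + d))) ≤ 1 := Real.exp_le_one_iff.2 (by nlinarith)
    have hw : Real.exp (-(κ * |u|)) ≤ 1 := Real.exp_le_one_iff.2 (by
      have := abs_nonneg u
      nlinarith)
    have hmain : 1 - Real.exp (-(κ * d / 2))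
        ≤ 2 - Real.exp (-(κ * (u + d))) - Real.exp (κ * u) := by
      rcases le_total u (-(d / 2)) with hc | hc
      · have : Real.exp (κ * u) ≤ Real.exp (-(κ * d / 2)) := Real.exp_le_exp.2 (by nlinarith)
        linarith
      · have : Real.exp (-(κ * (u + d))) ≤ Real.exp (-(κ * d / 2)) :=
          Real.exp_le_exp.2 (by nlinarith)
        linarith
    refine le_trans ?_ hmain
    nlinarith
  · push Not at h2
    rw [abs_of_pos h2, mul_add, neg_add, Real.exp_add]
    nlinarith [Real.exp_pos (-(κ * u))]

/-- The increments of `decayPrimitive` telescope, so the bound is uniform in the starting point and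
in the number of terms. -/
theorem sum_exp_decay_le {κ d : ℝ} (hκ : 0 < κ) (hd : 0 < d) (s : ℝ) (n : ℕ) :
    ∑ i ∈ Finset.range n, Real.exp (-(κ * |s + i * d|)) ≤ 2 / (1 - Real.exp (-(κ * d / 2))) := by
  have hlt : Real.exp (-(κ * d / 2)) < 1 := Real.exp_lt_one_iff.2 (by
    have : 0 < κ * d := by positivity
    linarith)
  rw [le_div_iff₀ (by linarith), mul_comm, Finset.mul_sum]
  have hstep : ∀ i : ℕ, (1 - Real.exp (-(κ * d / 2))) * Real.exp (-(κ * |s + i * d|))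
      ≤ decayPrimitive κ (s + (i + 1 : ℕ) * d) - decayPrimitive κ (s + i * d) := fun i => by
    have := decayPrimitive_increment hκ hd (s + i * d)
    rwa [show s + i * d + d = s + (i + 1 : ℕ) * d by push_cast; ring] at this
  refine (Finset.sum_le_sum fun i _ => hstep i).trans ?_
  rw [Finset.sum_range_sub fun i : ℕ => decayPrimitive κ (s + i * d)]
  have h1 := decayPrimitive_le_two hκ (s + n * d)
  have h2 := decayPrimitive_nonneg hκ (s + (0 : ℕ) * d)
  linarith

/-- Every binomial weight is at most 1/√(m+1), and the values of g along the progression have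
bounded sum, wherever the progression starts. -/
theorem coinAvg_le_of_exp_decay {a₁ a₂ κ : ℝ} (hκ : 0 < κ) (h : a₁ < a₂) {g : ℝ → ℝ}
    (hg : ∀ u, g u ≤ Real.exp (-(κ * |u|))) (m : ℕ) (s : ℝ) :
    coinAvg a₁ a₂ m g s
      ≤ 2 / (1 - Real.exp (-(κ * (a₂ - a₁) / 2))) * (1 / Real.sqrt (m + 1)) := by
  refine le_trans ?_ (mul_le_mul_of_nonneg_right
    (sum_exp_decay_le hκ (sub_pos.2 h) (s + m * a₁) (m + 1)) (by positivity))
  rw [Finset.sum_mul]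
  refine Finset.sum_le_sum fun i _ => ?_
  rw [mul_comm]
  exact mul_le_mul (hg _) (choose_div_two_pow_le m i) (by positivity) (Real.exp_pos _).le

/-! ### Local bounds for sums of independent letters -/

section LocalBounds

variable {Ω : Type*} [Fintype Ω] {p a : Ω → ℝ} {y₁ y₂ : Ω}

theorem sum_splitWeight (hp1 : ∑ ω, p ω = 1) (ε : ℝ) :
    ∑ o, splitWeight p y₁ y₂ ε o = 1 := by
  have := sum_splitWeight_mul p y₁ y₂ ε fun _ => 1
  simp only [mul_one] at this
  rw [this, hp1]
  ring

/-- The squared deviation of the number of coins from its mean, in expectation. -/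
theorem seqExp_coinCount_sq (hp1 : ∑ ω, p ω = 1) (ε : ℝ) (N : ℕ) :
    seqExp (splitWeight p y₁ y₂ ε) N (fun o => (((∑ i, coinCount (o i) : ℕ) : ℝ) - N * (2 * ε)) ^ 2)
      = N * (2 * ε * (1 - 2 * ε)) := by
  have h1 := sum_splitWeight (y₁ := y₁) (y₂ := y₂) hp1 ε
  have h2 : ∀ F : ℝ → ℝ, ∑ o, splitWeight p y₁ y₂ ε o * F ((coinCount o : ℝ) - 2 * ε)
      = 2 * ε * F (1 - 2 * ε) + (1 - 2 * ε) * F (-(2 * ε)) := fun F => by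
    rw [sum_splitWeight_mul]
    simp only [coinCount, Nat.cast_one, Nat.cast_zero, zero_sub, ← Finset.sum_mul, hp1]
    ring
  have h3 := h2 fun t => t
  have h4 := h2 fun t => t ^ 2
  have h5 := seqExp_sum_sq (N := N) h1 (fun o => (coinCount o : ℝ) - 2 * ε) (h3.trans (by ring))
  rw [h4] at h5
  simp only [Finset.sum_sub_distrib, Finset.sum_const, Finset.card_univ, Fintype.card_fin,
    nsmul_eq_mul] at h5
  push_cast
  rw [h5]
  ring

/-- The number of coins has mean 2Nε and variance O(N). Where it is of order N the coins alone give
1/√N; the rest has probability O(1/N) by Chebyshev. -/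
theorem seqExp_le_of_exp_decay (hp : ∀ ω, 0 ≤ p ω) (hp1 : ∑ ω, p ω = 1)
    (h₁ : 0 < p y₁) (h₂ : 0 < p y₂) (ha : a y₁ < a y₂) {κ : ℝ} (hκ : 0 < κ) {g : ℝ → ℝ}
    (hg : ∀ u, g u ≤ Real.exp (-(κ * |u|))) :
    ∃ K : ℝ, 0 < K ∧ ∀ N : ℕ, 1 ≤ N →
      seqExp p N (fun ω => g (∑ i, a (ω i))) ≤ K / Real.sqrt N := by
  set ε : ℝ := min (p y₁) (p y₂) with hε
  have hε0 : 0 < ε := lt_min h₁ h₂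
  have hne : y₁ ≠ y₂ := by rintro rfl; exact lt_irrefl _ ha
  set B : ℝ := 2 / (1 - Real.exp (-(κ * (a y₂ - a y₁) / 2))) with hB
  have hB0 : 0 < B := by
    refine div_pos two_pos (sub_pos.2 (Real.exp_lt_one_iff.2 ?_))
    have : 0 < κ * (a y₂ - a y₁) := mul_pos hκ (sub_pos.2 ha)
    linarith
  refine ⟨B * (1 / Real.sqrt ε + 2 / ε), by positivity, fun N hN => ?_⟩
  have hN0 : (0 : ℝ) < N := by exact_mod_cast hN
  have hw := splitWeight_nonneg hp hε0.le (min_le_left _ _) (min_le_right _ _) hne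
  rw [seqExp_eq_split p a y₁ y₂ ε]
  -- Chebyshev's inequality in pointwise form: when there are fewer than about Nε coins, the squared
  -- deviation divided by (Nε)² is at least 1 and pays for the trivial bound 1/√(m+1) ≤ 1.
  have hpt : ∀ o : Fin N → Option Ω,
      coinAvg (a y₁) (a y₂) (∑ i, coinCount (o i)) g (∑ i, (o i).elim 0 a)
        ≤ B * (1 / Real.sqrt (N * ε)) + B / (N * ε) ^ 2 *
          (((∑ i, coinCount (o i) : ℕ) : ℝ) - N * (2 * ε)) ^ 2 := by
    intro o
    set m := ∑ i, coinCount (o i)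
    refine (coinAvg_le_of_exp_decay hκ ha hg m _).trans ?_
    rw [div_mul_eq_mul_div B, mul_div_assoc B, ← mul_add]
    refine mul_le_mul_of_nonneg_left ?_ hB0.le
    rcases le_total (N * ε) (m + 1 : ℝ) with hc | hc
    · have h3 : 1 / Real.sqrt (m + 1) ≤ 1 / Real.sqrt (N * ε) :=
        one_div_le_one_div_of_le (Real.sqrt_pos.2 (by positivity)) (Real.sqrt_le_sqrt hc)
      have h4 : 0 ≤ ((m : ℝ) - N * (2 * ε)) ^ 2 / (N * ε) ^ 2 := by positivity
      linarith
    · have h3 : 1 / Real.sqrt ((m : ℝ) + 1) ≤ 1 := by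
        rw [div_le_one (Real.sqrt_pos.2 (by positivity))]
        exact Real.one_le_sqrt.2 (by have : (0 : ℝ) ≤ m := by positivity
                                     linarith)
      have h4 : 1 ≤ ((m : ℝ) - N * (2 * ε)) ^ 2 / (N * ε) ^ 2 := by
        rw [one_le_div (by positivity)]
        have : (0 : ℝ) < N * ε := by positivity
        nlinarith
      have h5 : 0 ≤ 1 / Real.sqrt (N * ε) := by positivity
      linarith
  refine (seqExp_mono hw hpt).trans ?_
  rw [seqExp_add, seqExp_const (sum_splitWeight hp1 ε), seqExp_const_mul,
    seqExp_coinCount_sq hp1]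
  have hsN : 0 < Real.sqrt N := Real.sqrt_pos.2 hN0
  have hsq : Real.sqrt N ^ 2 = N := Real.sq_sqrt hN0.le
  have h1N : 1 ≤ Real.sqrt N := Real.one_le_sqrt.2 (by exact_mod_cast hN)
  have e1 : B * (1 / Real.sqrt (N * ε)) = B * (1 / Real.sqrt ε) / Real.sqrt N := by
    rw [Real.sqrt_mul hN0.le]
    field_simp
  have e2 : B / (N * ε) ^ 2 * (N * (2 * ε * (1 - 2 * ε))) ≤ B * (2 / ε) / Real.sqrt N := by
    have : B / (N * ε) ^ 2 * (N * (2 * ε * (1 - 2 * ε))) = B * (2 / ε) * ((1 - 2 * ε) / N) := by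
      field_simp
    rw [this]
    have : (1 - 2 * ε) / N ≤ 1 / Real.sqrt N := by
      rw [div_le_div_iff₀ hN0 hsN]
      nlinarith
    have h0 : 0 ≤ B * (2 / ε) := by positivity
    calc B * (2 / ε) * ((1 - 2 * ε) / N)
        ≤ B * (2 / ε) * (1 / Real.sqrt N) := by gcongr
      _ = _ := by ring
  rw [e1]
  refine (add_le_add_right e2 _).trans (le_of_eq ?_)
  ring

end LocalBounds

/-- The half-open window has length equal to the step of the progression, so some point falls in it.
As the centre of the progression is within t of 0, that point has index within r of m/2, where the
binomial weight is large; this one term suffices. -/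
theorem le_coinAvg_of_window {a₁ a₂ c r t s : ℝ} (h : a₁ < a₂) {g : ℝ → ℝ} (hc : 0 ≤ c)
    (hg0 : ∀ u, 0 ≤ g u) (hg : ∀ u, -1 - (a₂ - a₁) ≤ u → u < -1 → c ≤ g u) {m : ℕ}
    (hr : 20 * r ≤ m) (ht : |s + m * ((a₁ + a₂) / 2)| ≤ t)
    (hrt : (1 + (a₂ - a₁) + t) / (a₂ - a₁) + 1 ≤ r) :
    Real.exp (-(40 * r ^ 2 / m)) / Real.sqrt (2 * m + 3) * c ≤ coinAvg a₁ a₂ m g s := by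
  set d := a₂ - a₁ with hd
  have hd0 : 0 < d := sub_pos.2 h
  set u := s + m * ((a₁ + a₂) / 2) with hu
  have hut := abs_le.1 ht
  have ht0 : 0 ≤ t := (abs_nonneg _).trans ht
  have hx : s + m * a₁ = u - m / 2 * d := by rw [hu, hd]; ring
  set w := (1 + d + u) / d with hw
  have hwd : w * d = 1 + d + u := by rw [hw]; field_simp
  have hwr : w + 1 ≤ r := by
    refine le_trans ?_ hrt
    rw [hw]
    gcongr
    exact hut.2
  have hwr' : 1 - r ≤ w := by
    have h1 : -((1 + d + t) / d) ≤ w := by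
      rw [hw, ← neg_div]
      gcongr
      linarith
    linarith
  have hr1 : 1 ≤ r := by
    have : 0 ≤ (1 + d + t) / d := by positivity
    linarith
  have hz : 0 ≤ (m : ℝ) / 2 - w := by linarith
  set i := ⌈(m : ℝ) / 2 - w⌉₊ with hi
  have hi1 : (m : ℝ) / 2 - w ≤ i := Nat.le_ceil _
  have hi2 : (i : ℝ) < m / 2 - w + 1 := Nat.ceil_lt_add_one hz
  have him : i ≤ m := by
    have : (i : ℝ) ≤ m := by linarith
    exact_mod_cast this
  have hcoef := choose_div_two_pow_ge m i r hr1 hr (by linarith) (by linarith)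
  have hgi : c ≤ g (s + m * a₁ + i * d) := by
    refine hg _ ?_ ?_
    · rw [hx]
      nlinarith
    · rw [hx]
      nlinarith
  refine (mul_le_mul hcoef hgi hc (by positivity)).trans ?_
  exact Finset.single_le_sum (f := fun i : ℕ => (m.choose i : ℝ) / 2 ^ m * g (s + m * a₁ + i * d))
    (fun j _ => mul_nonneg (by positivity) (hg0 _)) (Finset.mem_range.2 (by omega))

theorem le_seqExp_of_window {Ω : Type*} [Fintype Ω] {p a : Ω → ℝ} {y₁ y₂ : Ω}
    (hp : ∀ ω, 0 ≤ p ω) (hp1 : ∑ ω, p ω = 1) (hpa : ∑ ω, p ω * a ω = 0)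
    (h₁ : 0 < p y₁) (h₂ : 0 < p y₂) (ha : a y₁ < a y₂) {c : ℝ} (hc : 0 < c) {g : ℝ → ℝ}
    (hg0 : ∀ u, 0 ≤ g u) (hg : ∀ u, -1 - (a y₂ - a y₁) ≤ u → u < -1 → c ≤ g u) :
    ∃ K : ℝ, 0 < K ∧ ∀ᶠ N : ℕ in Filter.atTop,
      K / Real.sqrt N ≤ seqExp p N (fun ω => g (∑ i, a (ω i))) := by
  set ε : ℝ := min (p y₁) (p y₂) with hε
  have hε0 : 0 < ε := lt_min h₁ h₂
  have hne : y₁ ≠ y₂ := by rintro rfl; exact lt_irrefl _ ha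
  have hw := splitWeight_nonneg hp hε0.le (min_le_left _ _) (min_le_right _ _) hne
  have hw1 := sum_splitWeight (y₁ := y₁) (y₂ := y₂) hp1 ε
  set d := a y₂ - a y₁ with hd
  have hd0 : 0 < d := sub_pos.2 ha
  -- the letters, with the coins replaced by their mean
  set v : Option Ω → ℝ := fun o => o.elim ((a y₁ + a y₂) / 2) a with hv
  have hv0 : ∑ o, splitWeight p y₁ y₂ ε o * v o = 0 := by
    rw [sum_splitWeight_mul]
    simp only [hv, Option.elim_none, Option.elim_some, hpa]
    ring
  set V := ∑ o, splitWeight p y₁ y₂ ε o * v o ^ 2 with hV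
  have hV0 : 0 ≤ V := Finset.sum_nonneg fun o _ => mul_nonneg (hw o) (sq_nonneg _)
  -- With D² ≥ 4V, the event |S| > D√N costs at most 1/4 by Chebyshev; the added 1 keeps D positive
  -- when V = 0.
  set D := Real.sqrt (4 * V + 1) with hD
  have hD2 : D ^ 2 = 4 * V + 1 := Real.sq_sqrt (by positivity)
  have hD0 : 0 < D := Real.sqrt_pos.2 (by positivity)
  -- Chosen so that r = D'√N is admissible for t = D√N in `le_coinAvg_of_window` for every N ≥ 1.
  set D' := (1 + d + D) / d + 1 with hD'
  have hD'0 : 0 < D' := by positivity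
  set c₀ := Real.exp (-(40 * D' ^ 2 / ε)) / 3 * c with hc₀
  have hc₀0 : 0 < c₀ := by positivity
  refine ⟨c₀ / 2, by positivity, ?_⟩
  -- The second condition ensures 20 D'√N ≤ Nε; the third makes the Chebyshev bound for the coin
  -- count at most 1/4.
  filter_upwards [Filter.eventually_ge_atTop 1,
    (tendsto_natCast_atTop_atTop (R := ℝ)).eventually_ge_atTop ((20 * D' / ε) ^ 2),
    (tendsto_natCast_atTop_atTop (R := ℝ)).eventually_ge_atTop (8 / ε)] with N hN hN1 hN2
  have hN0 : (0 : ℝ) < N := by exact_mod_cast hN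
  have hsN : 0 < Real.sqrt N := Real.sqrt_pos.2 hN0
  have hsq : Real.sqrt N ^ 2 = N := Real.sq_sqrt hN0.le
  have h1N : 1 ≤ Real.sqrt N := Real.one_le_sqrt.2 (by exact_mod_cast hN)
  have hND : 20 * D' ≤ ε * Real.sqrt N := by
    have := Real.le_sqrt_of_sq_le hN1
    rwa [div_le_iff₀ hε0, mul_comm (Real.sqrt N)] at this
  have hNε : 8 ≤ N * ε := (div_le_iff₀ hε0).1 hN2
  rw [seqExp_eq_split p a y₁ y₂ ε]
  -- The left side is c₀/√N times one minus two normalised squared deviations. It is at most c₀/√N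
  -- when both are at most 1, and negative otherwise, where nonnegativity of g is enough. Its
  -- expectation is at least half of c₀/√N.
  have hpt : ∀ o : Fin N → Option Ω,
      c₀ / Real.sqrt N * 1 + (-(c₀ / Real.sqrt N / (D ^ 2 * N)) * (∑ i, v (o i)) ^ 2
        + -(c₀ / Real.sqrt N / (N * ε) ^ 2) *
          (((∑ i, coinCount (o i) : ℕ) : ℝ) - N * (2 * ε)) ^ 2)
      ≤ coinAvg (a y₁) (a y₂) (∑ i, coinCount (o i)) g (∑ i, (o i).elim 0 a) := by
    intro o
    set m := ∑ i, coinCount (o i) with hm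
    have hmN : (m : ℝ) ≤ N := by exact_mod_cast sum_coinCount_le o
    set S := ∑ i, v (o i) with hS
    have hSv : ∑ i, (o i).elim 0 a + m * ((a y₁ + a y₂) / 2) = S := by
      rw [hm, hS]
      push_cast
      rw [Finset.sum_mul, ← Finset.sum_add_distrib]
      refine Finset.sum_congr rfl fun i _ => ?_
      rw [hv]
      cases o i <;> simp [coinCount]
    have hfac : c₀ / Real.sqrt N * 1 + (-(c₀ / Real.sqrt N / (D ^ 2 * N)) * S ^ 2
        + -(c₀ / Real.sqrt N / (N * ε) ^ 2) * ((m : ℝ) - N * (2 * ε)) ^ 2)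
        = c₀ / Real.sqrt N * (1 - S ^ 2 / (D ^ 2 * N)
          - ((m : ℝ) - N * (2 * ε)) ^ 2 / (N * ε) ^ 2) := by ring
    rw [hfac]
    have hA : 0 ≤ S ^ 2 / (D ^ 2 * N) := by positivity
    have hB : 0 ≤ ((m : ℝ) - N * (2 * ε)) ^ 2 / (N * ε) ^ 2 := by positivity
    have hC : 0 ≤ c₀ / Real.sqrt N := by positivity
    by_cases hgood : S ^ 2 / (D ^ 2 * N) ≤ 1 ∧ ((m : ℝ) - N * (2 * ε)) ^ 2 / (N * ε) ^ 2 ≤ 1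
    · obtain ⟨g1, g2⟩ := hgood
      rw [div_le_one (by positivity)] at g1 g2
      have hSb : |S| ≤ D * Real.sqrt N := by
        refine abs_le_of_sq_le_sq ?_ (by positivity)
        rwa [mul_pow, hsq]
      have hmb : N * ε ≤ m := by
        have := (abs_le.1 (abs_le_of_sq_le_sq g2 (by positivity))).1
        linarith
      have hm0 : (0 : ℝ) < m := lt_of_lt_of_le (by positivity) hmb
      have hr : 20 * (D' * Real.sqrt N) ≤ m := by
        refine le_trans ?_ hmb
        calc 20 * (D' * Real.sqrt N) = 20 * D' * Real.sqrt N := by ring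
          _ ≤ ε * Real.sqrt N * Real.sqrt N := mul_le_mul_of_nonneg_right hND hsN.le
          _ = N * ε := by rw [mul_assoc, ← sq, hsq, mul_comm]
      have hwin : (1 + d + D * Real.sqrt N) / d + 1 ≤ D' * Real.sqrt N := by
        rw [hD', add_mul, one_mul, div_mul_eq_mul_div]
        refine add_le_add ?_ h1N
        refine div_le_div_of_nonneg_right ?_ hd0.le
        have := mul_le_mul_of_nonneg_left h1N (show 0 ≤ 1 + d by linarith)
        linarith
      have hmain := le_coinAvg_of_window ha hc.le hg0 hg hr
        ((congrArg abs hSv).le.trans hSb) hwin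
      refine le_trans ?_ hmain
      refine (mul_le_of_le_one_right hC (by linarith)).trans ?_
      rw [hc₀, mul_div_right_comm]
      refine mul_le_mul_of_nonneg_right ?_ hc.le
      rw [div_div]
      refine div_le_div₀ (Real.exp_pos _).le ?_ (Real.sqrt_pos.2 (by positivity)) ?_
      · refine Real.exp_le_exp.2 (neg_le_neg ?_)
        rw [div_le_div_iff₀ hm0 hε0, mul_pow, hsq]
        have := mul_le_mul_of_nonneg_left hmb (show 0 ≤ 40 * D' ^ 2 by positivity)
        linarith
      · have : (1 : ℝ) ≤ N := by exact_mod_cast hN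
        refine Real.sqrt_le_iff.2 ⟨by positivity, ?_⟩
        rw [mul_pow, hsq]
        linarith
    · refine le_trans (mul_nonpos_of_nonneg_of_nonpos hC ?_) ?_
      · by_contra hcon
        push Not at hcon
        exact hgood ⟨by linarith, by linarith⟩
      · exact Finset.sum_nonneg fun i _ => mul_nonneg (by positivity) (hg0 _)
  refine le_trans ?_ (seqExp_mono hw hpt)
  rw [seqExp_add, seqExp_add, seqExp_const hw1, seqExp_const_mul, seqExp_const_mul,
    seqExp_coinCount_sq hp1, seqExp_sum_sq hw1 v hv0, ← hV]
  have hC : 0 < c₀ / Real.sqrt N := by positivity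
  have f1 : V / D ^ 2 ≤ 1 / 4 := by
    rw [div_le_iff₀ (by positivity), hD2]
    linarith
  have f2 : 2 * (1 - 2 * ε) / (N * ε) ≤ 1 / 4 := by
    rw [div_le_iff₀ (by positivity)]
    linarith
  have f3 : c₀ / Real.sqrt N * 1 + (-(c₀ / Real.sqrt N / (D ^ 2 * N)) * (N * V)
      + -(c₀ / Real.sqrt N / (N * ε) ^ 2) * (N * (2 * ε * (1 - 2 * ε))))
      = c₀ / Real.sqrt N * (1 - V / D ^ 2 - 2 * (1 - 2 * ε) / (N * ε)) := by
    field_simp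
    ring
  rw [f3]
  have f4 : c₀ / 2 / Real.sqrt N = c₀ / Real.sqrt N * (1 / 2) := by ring
  rw [f4]
  refine mul_le_mul_of_nonneg_left ?_ hC.le
  linarith

/-- A positive sequence which is eventually at least of order `1 / √N` is so from the start. -/
theorem exists_div_sqrt_le_of_eventually {u : ℕ → ℝ} (hu : ∀ N, 1 ≤ N → 0 < u N) {K : ℝ}
    (hK : 0 < K) (h : ∀ᶠ N : ℕ in Filter.atTop, K / Real.sqrt N ≤ u N) :
    ∃ K' : ℝ, 0 < K' ∧ ∀ N : ℕ, 1 ≤ N → K' / Real.sqrt N ≤ u N := by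
  obtain ⟨n, hn⟩ := Filter.eventually_atTop.1 h
  have hsmall : ∀ n : ℕ, ∃ L : ℝ, 0 < L ∧ ∀ N, 1 ≤ N → N < n → L ≤ u N := by
    intro n
    induction n with
    | zero => exact ⟨1, one_pos, fun N _ h => absurd h (Nat.not_lt_zero _)⟩
    | succ n ih =>
      obtain ⟨L, hL, hLu⟩ := ih
      rcases Nat.eq_zero_or_pos n with rfl | hn
      · exact ⟨1, one_pos, fun N h h' => by omega⟩
      · refine ⟨min L (u n), lt_min hL (hu n hn), fun N h1 h2 => ?_⟩
        rcases Nat.lt_succ_iff_lt_or_eq.1 h2 with h3 | rfl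
        · exact (min_le_left _ _).trans (hLu N h1 h3)
        · exact min_le_right _ _
  obtain ⟨L, hL, hLu⟩ := hsmall n
  refine ⟨min K L, lt_min hK hL, fun N hN => ?_⟩
  have h1N : 1 ≤ Real.sqrt N := Real.one_le_sqrt.2 (by exact_mod_cast hN)
  rcases lt_or_ge N n with h | h
  · refine le_trans ?_ (hLu N hN h)
    exact (div_le_self (lt_min hK hL).le h1N).trans (min_le_right _ _)
  · refine le_trans ?_ (hn N h)
    gcongr
    exact min_le_left _ _

/-! ### Exponential tilting -/

/-- The Laplace transform at `ρ` of `b` under the weights `q`. -/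
noncomputable def laplace {Ω : Type*} [Fintype Ω] (q b : Ω → ℝ) (ρ : ℝ) : ℝ :=
  ∑ ω, q ω * Real.exp (-(ρ * b ω))

section Tilt

variable {Ω : Type*} [Fintype Ω] {q b : Ω → ℝ}

theorem laplace_pos (hq : ∀ ω, 0 ≤ q ω) (hq1 : ∑ ω, q ω = 1) (b : Ω → ℝ) (ρ : ℝ) :
    0 < laplace q b ρ := by
  have hne : ∑ ω, q ω ≠ 0 := by rw [hq1]; exact one_ne_zero
  obtain ⟨ω, -, hω⟩ := Finset.exists_ne_zero_of_sum_ne_zero hne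
  exact Finset.sum_pos' (fun ω _ => mul_nonneg (hq ω) (Real.exp_pos _).le)
    ⟨ω, Finset.mem_univ ω, mul_pos ((hq ω).lt_of_ne' hω) (Real.exp_pos _)⟩

theorem laplace_zero (hq1 : ∑ ω, q ω = 1) (b : Ω → ℝ) : laplace q b 0 = 1 := by
  simp [laplace, hq1]

theorem laplace_sub_const (q b : Ω → ℝ) (r ρ : ℝ) :
    laplace q (fun ω => b ω - r) ρ = Real.exp (ρ * r) * laplace q b ρ := by
  unfold laplace
  rw [Finset.mul_sum]
  refine Finset.sum_congr rfl fun ω _ => ?_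
  rw [show -(ρ * (b ω - r)) = ρ * r + -(ρ * b ω) by ring, Real.exp_add]
  ring

theorem hasDerivAt_laplace (q b : Ω → ℝ) (ρ : ℝ) :
    HasDerivAt (laplace q b) (-∑ ω, q ω * Real.exp (-(ρ * b ω)) * b ω) ρ := by
  unfold laplace
  rw [← Finset.sum_neg_distrib]
  refine HasDerivAt.fun_sum fun ω _ => ?_
  have := (((hasDerivAt_id ρ).mul_const (b ω)).neg.exp).const_mul (q ω)
  refine this.congr_deriv ?_
  simp only [Pi.neg_apply, id, one_mul]
  ring

theorem continuous_laplace (q b : Ω → ℝ) : Continuous (laplace q b) :=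
  continuous_iff_continuousAt.2 fun ρ => (hasDerivAt_laplace q b ρ).continuousAt

/-- A minimum of the Laplace transform over the half line `0 ≤ ρ` is a critical point when the mean
of `b` is positive. -/
theorem critical_of_isMin_laplace (hb : 0 < ∑ ω, q ω * b ω) {ρ : ℝ} (hρ : 0 ≤ ρ)
    (hmin : ∀ t, 0 ≤ t → laplace q b ρ ≤ laplace q b t) :
    0 < ρ ∧ ∑ ω, q ω * Real.exp (-(ρ * b ω)) * b ω = 0 := by
  have hder := hasDerivAt_laplace q b ρ
  have hpos : 0 < ρ := by
    refine hρ.lt_of_ne fun h => ?_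
    subst h
    -- At ρ = 0 the minimum is only one-sided. Right slopes are nonnegative there, whereas the
    -- derivative is minus the mean of b.
    have h1 := (hasDerivAt_iff_tendsto_slope.1 hder).mono_left
      (nhdsWithin_mono (0 : ℝ) fun t (ht : t ∈ Set.Ioi (0 : ℝ)) => ne_of_gt ht)
    have h2 : (0 : ℝ) ≤ -∑ ω, q ω * Real.exp (-(0 * b ω)) * b ω := by
      refine ge_of_tendsto h1 ?_
      filter_upwards [self_mem_nhdsWithin] with t ht
      have ht0 : (0 : ℝ) < t := ht
      rw [slope_def_field]
      exact div_nonneg (sub_nonneg.2 (hmin t ht0.le)) (by linarith)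
    simp only [zero_mul, neg_zero, Real.exp_zero, mul_one] at h2
    linarith
  refine ⟨hpos, ?_⟩
  have hloc : IsLocalMin (laplace q b) ρ := by
    filter_upwards [lt_mem_nhds hpos] with t ht
    exact hmin t (le_of_lt ht)
  have := hloc.hasDerivAt_eq_zero hder
  linarith

/-- Cramér's change of measure: the letterwise densities multiply to e^{−ρS} divided by the N-th
power of the normaliser, and the right side undoes this. -/
theorem seqExp_eq_tilt (hq : ∀ ω, 0 ≤ q ω) (hq1 : ∑ ω, q ω = 1) (b : Ω → ℝ) (ρ : ℝ) (N : ℕ)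
    (g : ℝ → ℝ) :
    seqExp q N (fun ω => g (∑ i, b (ω i))) = laplace q b ρ ^ N *
      seqExp (fun ω => q ω * Real.exp (-(ρ * b ω)) / laplace q b ρ) N
        (fun ω => Real.exp (ρ * ∑ i, b (ω i)) * g (∑ i, b (ω i))) := by
  have hZ := (laplace_pos hq hq1 b ρ).ne'
  unfold seqExp
  rw [Finset.mul_sum]
  refine Finset.sum_congr rfl fun ω _ => ?_
  have h : ∏ i, q (ω i) * Real.exp (-(ρ * b (ω i))) / laplace q b ρ
      = (∏ i, q (ω i)) * Real.exp (-(ρ * ∑ i, b (ω i))) / laplace q b ρ ^ N := by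
    rw [Finset.prod_div_distrib, Finset.prod_mul_distrib, ← Real.exp_sum, Finset.mul_sum,
      Finset.sum_neg_distrib]
    simp
  rw [h, Real.exp_neg]
  field_simp

/-- The hypotheses on a tilted law: it is a centred, nondegenerate probability distribution. -/
theorem tilt_spec (hq : ∀ ω, 0 ≤ q ω) (hq1 : ∑ ω, q ω = 1) (hb : 0 < ∑ ω, q ω * b ω) {ρ : ℝ}
    (hcrit : ∑ ω, q ω * Real.exp (-(ρ * b ω)) * b ω = 0) {p : Ω → ℝ}
    (hp : p = fun ω => q ω * Real.exp (-(ρ * b ω)) / laplace q b ρ) :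
    (∀ ω, 0 ≤ p ω) ∧ ∑ ω, p ω = 1 ∧ ∑ ω, p ω * b ω = 0 ∧
      ∃ y₁ y₂, 0 < q y₁ ∧ 0 < p y₁ ∧ 0 < p y₂ ∧ b y₁ < 0 ∧ 0 < b y₂ := by
  have hZ := laplace_pos hq hq1 b ρ
  have hpos : ∀ ω, 0 < q ω → 0 < p ω := fun ω h => by rw [hp]; positivity
  have hp0 : ∀ ω, 0 ≤ p ω := fun ω => by
    rw [hp]
    exact div_nonneg (mul_nonneg (hq ω) (Real.exp_pos _).le) hZ.le
  have hpb : ∑ ω, p ω * b ω = 0 := by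
    have : ∀ ω, p ω * b ω = q ω * Real.exp (-(ρ * b ω)) * b ω / laplace q b ρ := fun ω => by
      rw [hp]; ring
    simp only [this, ← Finset.sum_div, hcrit, zero_div]
  refine ⟨hp0, ?_, hpb, ?_⟩
  · rw [hp, ← Finset.sum_div]
    exact div_self hZ.ne'
  · obtain ⟨y₂, -, hy₂⟩ : ∃ y ∈ Finset.univ, 0 < q y * b y := by
      by_contra hcon
      push Not at hcon
      exact absurd (Finset.sum_nonpos hcon) (not_le.2 hb)
    have hb₂ : 0 < b y₂ := pos_of_mul_pos_right hy₂ (hq _)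
    have hq₂ : 0 < q y₂ := pos_of_mul_pos_left hy₂ hb₂.le
    -- A centred law with mass where b is positive must also have mass where b is negative.
    obtain ⟨y₁, -, hy₁⟩ : ∃ y ∈ Finset.univ, p y * b y < 0 := by
      by_contra hcon
      push Not at hcon
      have h0 := (Finset.sum_eq_zero_iff_of_nonneg hcon).1 hpb y₂ (Finset.mem_univ _)
      exact absurd h0 (mul_pos (hpos _ hq₂) hb₂).ne'
    have hb₁ : b y₁ < 0 := by
      by_contra hcon
      exact absurd hy₁ (not_lt.2 (mul_nonneg (hp0 _) (not_lt.1 hcon)))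
    have hp₁ : p y₁ ≠ 0 := fun h => by simp [h] at hy₁
    have hq₁ : q y₁ ≠ 0 := fun h => hp₁ (by rw [hp]; simp [h])
    exact ⟨y₁, y₂, (hq _).lt_of_ne' hq₁, (hp0 _).lt_of_ne' hp₁, hpos _ hq₂, hb₁, hb₂⟩

/-- Exact asymptotics of a Chernoff bound, upper half. -/
theorem seqExp_min_le (hq : ∀ ω, 0 ≤ q ω) (hq1 : ∑ ω, q ω = 1) (hb : 0 < ∑ ω, q ω * b ω) {ρ : ℝ}
    (h0 : 0 < ρ) (h1 : ρ < 1) (hcrit : ∑ ω, q ω * Real.exp (-(ρ * b ω)) * b ω = 0) :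
    ∃ K : ℝ, 0 < K ∧ ∀ N : ℕ, 1 ≤ N →
      seqExp q N (fun ω => min 1 (Real.exp (-∑ i, b (ω i))))
        ≤ K / Real.sqrt N * laplace q b ρ ^ N := by
  obtain ⟨hp0, hp1, -, y₁, y₂, -, hp₁, hp₂, hb₁, hb₂⟩ := tilt_spec hq hq1 hb hcrit rfl
  -- The left side is e^{−(1−ρ)u} for u ≥ 0 and e^{ρu} for u ≤ 0, so decay on both sides uses 0 < ρ
  -- < 1.
  have hg : ∀ u : ℝ, Real.exp (ρ * u) * min 1 (Real.exp (-u))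
      ≤ Real.exp (-(min ρ (1 - ρ) * |u|)) := by
    intro u
    rcases le_total 0 u with hu | hu
    · calc Real.exp (ρ * u) * min 1 (Real.exp (-u)) ≤ Real.exp (ρ * u) * Real.exp (-u) := by
            gcongr
            exact min_le_right _ _
        _ = Real.exp (-((1 - ρ) * u)) := by rw [← Real.exp_add]; congr 1; ring
        _ ≤ _ := by
            rw [abs_of_nonneg hu]
            refine Real.exp_le_exp.2 (neg_le_neg (mul_le_mul_of_nonneg_right (min_le_right _ _) hu))
    · calc Real.exp (ρ * u) * min 1 (Real.exp (-u)) ≤ Real.exp (ρ * u) * 1 := by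
            gcongr
            exact min_le_left _ _
        _ = Real.exp (-(ρ * -u)) := by rw [mul_one]; congr 1; ring
        _ ≤ _ := by
            rw [abs_of_nonpos hu]
            refine Real.exp_le_exp.2 (neg_le_neg (mul_le_mul_of_nonneg_right (min_le_left _ _) ?_))
            linarith
  obtain ⟨K, hK, hKN⟩ := seqExp_le_of_exp_decay hp0 hp1 hp₁ hp₂ (hb₁.trans hb₂)
    (lt_min h0 (sub_pos.2 h1)) hg
  refine ⟨K, hK, fun N hN => ?_⟩
  rw [seqExp_eq_tilt hq hq1 b ρ N fun u => min 1 (Real.exp (-u)), mul_comm]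
  exact mul_le_mul_of_nonneg_right (hKN N hN) (pow_pos (laplace_pos hq hq1 b ρ) N).le

/-- Exact asymptotics of a Chernoff bound, lower half. -/
theorem le_seqExp_max (hq : ∀ ω, 0 ≤ q ω) (hq1 : ∑ ω, q ω = 1) (hb : 0 < ∑ ω, q ω * b ω) {ρ : ℝ}
    (h0 : 0 < ρ) (hcrit : ∑ ω, q ω * Real.exp (-(ρ * b ω)) * b ω = 0) :
    ∃ K : ℝ, 0 < K ∧ ∀ N : ℕ, 1 ≤ N →
      K / Real.sqrt N * laplace q b ρ ^ N
        ≤ seqExp q N (fun ω => max 0 (1 - Real.exp (∑ i, b (ω i)))) := by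
  obtain ⟨hp0, hp1, hpb, y₁, y₂, hq₁, hp₁, hp₂, hb₁, hb₂⟩ := tilt_spec hq hq1 hb hcrit rfl
  have hZ := laplace_pos hq hq1 b ρ
  set d := b y₂ - b y₁ with hd
  set c := Real.exp (ρ * (-1 - d)) * (1 - Real.exp (-1)) with hc
  have he1 : Real.exp (-1) < 1 := Real.exp_lt_one_iff.2 (by norm_num)
  have hc0 : 0 < c := mul_pos (Real.exp_pos _) (sub_pos.2 he1)
  have hg0 : ∀ u : ℝ, 0 ≤ Real.exp (ρ * u) * max 0 (1 - Real.exp u) := fun u =>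
    mul_nonneg (Real.exp_pos _).le (le_max_left _ _)
  have hg : ∀ u : ℝ, -1 - d ≤ u → u < -1 → c ≤ Real.exp (ρ * u) * max 0 (1 - Real.exp u) := by
    intro u hu1 hu2
    refine mul_le_mul ?_ ?_ (sub_pos.2 he1).le (Real.exp_pos _).le
    · exact Real.exp_le_exp.2 (mul_le_mul_of_nonneg_left hu1 h0.le)
    · refine le_trans ?_ (le_max_right _ _)
      exact sub_le_sub_left (Real.exp_le_exp.2 hu2.le) _
  obtain ⟨K, hK, hKN⟩ := le_seqExp_of_window hp0 hp1 hpb hp₁ hp₂ (hb₁.trans hb₂) hc0 hg0 hg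
  set u : ℕ → ℝ := fun N =>
    seqExp q N (fun ω => max 0 (1 - Real.exp (∑ i, b (ω i)))) / laplace q b ρ ^ N with hu
  -- Needed to pass from large N to all N ≥ 1: the constant sequence at y₁ has positive weight and a
  -- negative sum.
  have hupos : ∀ N, 1 ≤ N → 0 < u N := by
    intro N hN
    refine div_pos ?_ (pow_pos hZ N)
    refine Finset.sum_pos' (fun ω _ => mul_nonneg (Finset.prod_nonneg fun _ _ => hq _)
      (le_max_left _ _)) ⟨fun _ => y₁, Finset.mem_univ _, ?_⟩
    refine mul_pos (Finset.prod_pos fun _ _ => hq₁) (lt_max_of_lt_right ?_)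
    refine sub_pos.2 (Real.exp_lt_one_iff.2 ?_)
    have : (0 : ℝ) < N := by exact_mod_cast hN
    simp only [Finset.sum_const, Finset.card_univ, Fintype.card_fin, nsmul_eq_mul]
    exact mul_neg_of_pos_of_neg this hb₁
  have hev : ∀ᶠ N : ℕ in Filter.atTop, K / Real.sqrt N ≤ u N := by
    filter_upwards [hKN] with N hN
    rw [hu]
    dsimp only
    rw [le_div_iff₀ (pow_pos hZ N), seqExp_eq_tilt hq hq1 b ρ N fun u => max 0 (1 - Real.exp u),
      mul_comm]
    exact mul_le_mul_of_nonneg_left hN (pow_pos hZ N).le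
  obtain ⟨K', hK', hKu⟩ := exists_div_sqrt_le_of_eventually hupos hK hev
  refine ⟨K', hK', fun N hN => ?_⟩
  exact (le_div_iff₀ (pow_pos hZ N)).1 (hKu N hN)

end Tilt

end LocalLimit

/-! ### Singular symmetric channels: structure, coding bounds and exponents. -/

namespace DMC

open LocalLimit

section Channel

variable {X Y : Type*}

/-! ### The structure of singular symmetric channels -/

open Classical in
/-- The fraction of the inputs that can lead to the output `y`. -/
noncomputable def supportFrac [Fintype X] (W : X → Y → ℝ) (y : Y) : ℝ :=
  (∑ x, if 0 < W x y then (1 : ℝ) else 0) / Fintype.card X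

open Classical in
/-- The common value of the positive entries in the column `y` of a singular channel. -/
noncomputable def columnValue [Fintype X] (W : X → Y → ℝ) (y : Y) : ℝ :=
  if h : ∃ x, 0 < W x y then W h.choose y else 0

/-- The output distribution under uniform inputs. -/
noncomputable def uniformOut [Fintype X] (W : X → Y → ℝ) (y : Y) : ℝ :=
  columnValue W y * supportFrac W y

/-- The information density between `y` and any input that can lead to `y`. -/
noncomputable def infoDensity [Fintype X] (W : X → Y → ℝ) (y : Y) : ℝ :=
  -Real.log (supportFrac W y)

variable {W : X → Y → ℝ}

theorem IsChannel.nonneg [Fintype Y] (hW : IsChannel W) (x : X) (y : Y) : 0 ≤ W x y := (hW x).1 y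

theorem IsChannel.sum_eq_one [Fintype Y] (hW : IsChannel W) (x : X) : ∑ y, W x y = 1 := (hW x).2

theorem IsSingular.eq_columnValue [Fintype X] (hs : IsSingular W) {x : X} {y : Y} (h : 0 < W x y) :
    W x y = columnValue W y := by
  have hex : ∃ x, 0 < W x y := ⟨x, h⟩
  rw [columnValue, dif_pos hex]
  exact hs x y _ (mul_pos h hex.choose_spec)

theorem columnValue_nonneg [Fintype X] (W : X → Y → ℝ) (y : Y) : 0 ≤ columnValue W y := by
  unfold columnValue
  split_ifs with h
  · exact h.choose_spec.le
  · exact le_rfl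

theorem supportFrac_nonneg [Fintype X] (W : X → Y → ℝ) (y : Y) : 0 ≤ supportFrac W y :=
  div_nonneg (Finset.sum_nonneg fun _ _ => by split_ifs <;> norm_num) (Nat.cast_nonneg _)

theorem supportFrac_pos [Fintype X] {x : X} {y : Y} (h : 0 < W x y) : 0 < supportFrac W y := by
  have hne : Nonempty X := ⟨x⟩
  refine div_pos ?_ (Nat.cast_pos.2 Fintype.card_pos)
  refine Finset.sum_pos' (fun _ _ => by split_ifs <;> norm_num) ⟨x, Finset.mem_univ x, ?_⟩
  rw [if_pos h]
  exact one_pos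

theorem columnValue_pos [Fintype X] {x : X} {y : Y} (h : 0 < W x y) : 0 < columnValue W y := by
  have hex : ∃ x, 0 < W x y := ⟨x, h⟩
  rw [columnValue, dif_pos hex]
  exact hex.choose_spec

theorem columnValue_eq_zero_of_supportFrac [Fintype X] {y : Y} (h : supportFrac W y = 0) :
    columnValue W y = 0 := by
  rw [columnValue, dif_neg]
  rintro ⟨x, hx⟩
  exact (supportFrac_pos hx).ne' h

theorem uniformOut_nonneg [Fintype X] (W : X → Y → ℝ) (y : Y) : 0 ≤ uniformOut W y :=
  mul_nonneg (columnValue_nonneg W y) (supportFrac_nonneg W y)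

theorem exp_neg_infoDensity [Fintype X] {y : Y} (h : 0 < supportFrac W y) :
    Real.exp (-infoDensity W y) = supportFrac W y := by
  rw [infoDensity, neg_neg, Real.exp_log h]

theorem outputDist_nonneg [Fintype X] {Q : X → ℝ} {V : X → Y → ℝ} (hQ : ∀ x, 0 ≤ Q x)
    (hV : ∀ x y, 0 ≤ V x y) (y : Y) : 0 ≤ outputDist Q V y :=
  Finset.sum_nonneg fun x _ => mul_nonneg (hQ x) (hV x y)

theorem le_outputDist [Fintype X] {Q : X → ℝ} {V : X → Y → ℝ} (hQ : ∀ x, 0 ≤ Q x)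
    (hV : ∀ x y, 0 ≤ V x y) (x : X) (y : Y) : Q x * V x y ≤ outputDist Q V y :=
  Finset.single_le_sum (f := fun x => Q x * V x y) (fun x _ => mul_nonneg (hQ x) (hV x y))
    (Finset.mem_univ x)

variable [Fintype X] [Fintype Y]

open Classical in
theorem channel_eq_ite (hW : IsChannel W) (hs : IsSingular W) (x : X) (y : Y) :
    W x y = columnValue W y * if 0 < W x y then 1 else 0 := by
  split_ifs with h
  · rw [mul_one, hs.eq_columnValue h]
  · rw [mul_zero]
    exact le_antisymm (not_lt.1 h) (hW.nonneg x y)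

theorem channel_le_columnValue (hW : IsChannel W) (hs : IsSingular W) (x : X) (y : Y) :
    W x y ≤ columnValue W y := by
  rcases (hW.nonneg x y).eq_or_lt with h | h
  · rw [← h]
    exact columnValue_nonneg W y
  · exact (hs.eq_columnValue h).le

theorem uniformOut_eq (hW : IsChannel W) (hs : IsSingular W) (y : Y) :
    uniformOut W y = (∑ x, W x y) / Fintype.card X := by
  classical
  rw [uniformOut, supportFrac, ← mul_div_assoc, Finset.mul_sum]
  congr 1
  refine Finset.sum_congr rfl fun x _ => ?_
  convert (channel_eq_ite hW hs x y).symm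

theorem sum_uniformOut_mul [Nonempty X] (hW : IsChannel W) (hs : IsSingular W) (h : Y → ℝ) :
    ∑ y, uniformOut W y * h y = (∑ x, ∑ y, W x y * h y) / Fintype.card X := by
  rw [Finset.sum_comm, Finset.sum_div]
  refine Finset.sum_congr rfl fun y _ => ?_
  rw [uniformOut_eq hW hs, ← Finset.sum_mul]
  ring

theorem sum_uniformOut [Nonempty X] (hW : IsChannel W) (hs : IsSingular W) :
    ∑ y, uniformOut W y = 1 := by
  have := sum_uniformOut_mul hW hs fun _ => 1
  simp only [mul_one, hW.sum_eq_one, Finset.sum_const, nsmul_eq_mul, Finset.card_univ] at this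
  rw [this]
  exact div_self (Nat.cast_ne_zero.2 Fintype.card_ne_zero)

/-- On a symmetric channel the law of `supportFrac` at the output does not depend on the input. -/
theorem sum_channel_mul_supportFrac_congr (hsym : IsSymmetric W) (h : ℝ → ℝ) (x x' : X) :
    ∑ y, W x' y * h (supportFrac W y) = ∑ y, W x y * h (supportFrac W y) := by
  classical
  obtain ⟨s, hs⟩ := hsym
  rw [← (Equiv.sigmaFiberEquiv (Quotient.mk s)).sum_comp,
    ← (Equiv.sigmaFiberEquiv (Quotient.mk s)).sum_comp, Fintype.sum_sigma, Fintype.sum_sigma]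
  refine Finset.sum_congr rfl fun c _ => ?_
  have hB : {y : Y | Quotient.mk s y = c} ∈ s.classes := by
    obtain ⟨y₀, rfl⟩ := Quotient.exists_rep c
    refine ⟨y₀, Set.ext fun y => ?_⟩
    exact Quotient.eq
  obtain ⟨hrow, hcol⟩ := hs _ hB
  obtain ⟨σ, hσ⟩ := hrow x x'
  -- Column permutations make the support fraction constant on a class; row permutations then carry
  -- the mass of one input to that of another within the class.
  have hfrac : ∀ y y' : {y : Y | Quotient.mk s y = c}, supportFrac W y' = supportFrac W y := by
    intro y y'
    obtain ⟨τ, hτ⟩ := hcol y y'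
    unfold supportFrac
    simp only [hτ]
    rw [Equiv.sum_comp τ fun x => if 0 < W x y then (1 : ℝ) else 0]
  change ∑ y : {y : Y | Quotient.mk s y = c}, W x' y * h (supportFrac W y)
    = ∑ y : {y : Y | Quotient.mk s y = c}, W x y * h (supportFrac W y)
  rw [← Equiv.sum_comp σ fun y : {y : Y | Quotient.mk s y = c} => W x y * h (supportFrac W y)]
  exact Finset.sum_congr rfl fun y _ => by rw [hσ, hfrac y (σ y)]

theorem sum_channel_mul_supportFrac (hW : IsChannel W) (hsym : IsSymmetric W)
    (hs : IsSingular W) (h : ℝ → ℝ) (x : X) :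
    ∑ y, W x y * h (supportFrac W y) = ∑ y, uniformOut W y * h (supportFrac W y) := by
  have : Nonempty X := ⟨x⟩
  rw [sum_uniformOut_mul hW hs, Finset.sum_congr rfl fun x' _ =>
    sum_channel_mul_supportFrac_congr hsym h x x', Finset.sum_const, nsmul_eq_mul,
    Finset.card_univ, mul_div_cancel_left₀]
  exact Nat.cast_ne_zero.2 Fintype.card_ne_zero

/-! ### Information quantities -/

/-- The pointwise form of Gibbs' inequality, from log t ≤ t − 1. -/
theorem sub_le_mul_log_div {p s : ℝ} (hp : 0 ≤ p) (hs : 0 ≤ s) (h : 0 < p → 0 < s) :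
    p - s ≤ p * Real.log (p / s) := by
  rcases hp.eq_or_lt with rfl | hp
  · simpa using hs
  · have hs' := h hp
    have hlog := Real.log_le_sub_one_of_pos (div_pos hs' hp)
    rw [← inv_div, Real.log_inv]
    have hm := mul_le_mul_of_nonneg_left hlog hp.le
    have : p * (s / p - 1) = s - p := by field_simp
    linarith

theorem sum_outputDist_mul (Q : X → ℝ) (V : X → Y → ℝ) (h : Y → ℝ) :
    ∑ y, outputDist Q V y * h y = ∑ x, ∑ y, Q x * V x y * h y := by
  simp only [outputDist, Finset.sum_mul]
  exact Finset.sum_comm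

theorem sum_outputDist {Q : X → ℝ} {V : X → Y → ℝ} (hQ : ∑ x, Q x = 1) (hV : IsChannel V) :
    ∑ y, outputDist Q V y = 1 := by
  have := sum_outputDist_mul Q V fun _ => 1
  simp only [mul_one, ← Finset.mul_sum, hV.sum_eq_one, hQ] at this
  exact this

/-- I(Q;W) equals the mean of J minus D(r‖q), where r is the output law of Q. By symmetry the first
term does not depend on Q, and the second is nonnegative. -/
theorem mutualInfo_le (hW : IsChannel W) (hsym : IsSymmetric W) (hs : IsSingular W)
    {Q : X → ℝ} (hQ : Q ∈ stdSimplex ℝ X) :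
    mutualInfo Q W ≤ ∑ y, uniformOut W y * infoDensity W y := by
  have hX : Nonempty X := by
    by_contra hcon
    rw [not_nonempty_iff] at hcon
    have := hQ.2
    simp at this
  set r := outputDist Q W with hr
  have hr0 : ∀ y, 0 ≤ r y := outputDist_nonneg hQ.1 hW.nonneg
  have hterm : ∀ x y, Q x * W x y * Real.log (W x y / r y)
      = Q x * W x y * infoDensity W y - Q x * W x y * Real.log (r y / uniformOut W y) := by
    intro x y
    rcases (mul_nonneg (hQ.1 x) (hW.nonneg x y)).eq_or_lt with h | h
    · rw [← h]; ring
    · have hr' : 0 < r y := h.trans_le (le_outputDist hQ.1 hW.nonneg x y)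
      have hWp : 0 < W x y := pos_of_mul_pos_right h (hQ.1 x)
      have hβ := supportFrac_pos hWp
      have hδ := columnValue_pos hWp
      rw [← mul_sub, hs.eq_columnValue hWp, infoDensity, uniformOut, Real.log_div hδ.ne' hr'.ne',
        Real.log_div hr'.ne' (mul_pos hδ hβ).ne', Real.log_mul hδ.ne' hβ.ne']
      ring
  have hJ : ∑ x, ∑ y, Q x * W x y * infoDensity W y = ∑ y, uniformOut W y * infoDensity W y := by
    have h1 : ∀ x, ∑ y, Q x * W x y * infoDensity W y
        = Q x * ∑ y, uniformOut W y * infoDensity W y := by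
      intro x
      have := sum_channel_mul_supportFrac hW hsym hs (fun t => -Real.log t) x
      simp only [infoDensity]
      rw [← this, Finset.mul_sum]
      exact Finset.sum_congr rfl fun y _ => by ring
    simp only [h1, ← Finset.sum_mul, hQ.2, one_mul]
  have hgibbs : 0 ≤ ∑ y, r y * Real.log (r y / uniformOut W y) := by
    have h1 : ∑ y, (r y - uniformOut W y) ≤ ∑ y, r y * Real.log (r y / uniformOut W y) := by
      refine Finset.sum_le_sum fun y _ =>
        sub_le_mul_log_div (hr0 y) (uniformOut_nonneg W y) fun h => ?_
      obtain ⟨x, -, hx⟩ := Finset.exists_ne_zero_of_sum_ne_zero (ne_of_gt h)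
      have hx' := (hW.nonneg x y).lt_of_ne' (right_ne_zero_of_mul hx)
      exact mul_pos (columnValue_pos hx') (supportFrac_pos hx')
    rwa [Finset.sum_sub_distrib, sum_outputDist hQ.2 hW, sum_uniformOut hW hs, sub_self] at h1
  rw [sum_outputDist_mul] at hgibbs
  unfold mutualInfo
  simp only [← hr, hterm, Finset.sum_sub_distrib, hJ]
  linarith

theorem bddAbove_mutualInfo (hW : IsChannel W) (hsym : IsSymmetric W) (hs : IsSingular W) :
    BddAbove (Set.range fun Q : stdSimplex ℝ X => mutualInfo (Q : X → ℝ) W) :=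
  ⟨_, by rintro _ ⟨Q, rfl⟩; exact mutualInfo_le hW hsym hs Q.2⟩

theorem nonempty_stdSimplex [Nonempty X] : Nonempty (stdSimplex ℝ X) := by
  classical
  exact ⟨⟨_, single_mem_stdSimplex ℝ (Classical.arbitrary X)⟩⟩

theorem capacity_le [Nonempty X] (hW : IsChannel W) (hsym : IsSymmetric W) (hs : IsSingular W) :
    capacity W ≤ ∑ y, uniformOut W y * infoDensity W y := by
  have : Nonempty (stdSimplex ℝ X) := nonempty_stdSimplex
  exact ciSup_le fun Q => mutualInfo_le hW hsym hs Q.2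

theorem condRelEntropy_self (W : X → Y → ℝ) (Q : X → ℝ) : condRelEntropy W W Q = 0 := by
  refine Finset.sum_eq_zero fun x _ => ?_
  simp [relEntropy]

theorem spherePackingExponent_eq_zero (hW : IsChannel W) (hsym : IsSymmetric W)
    (hs : IsSingular W) {R : ℝ} (hR : capacity W ≤ R) : spherePackingExponent W R = 0 := by
  refine le_antisymm (iSup_le fun Q => ?_) bot_le
  have hI : mutualInfo (Q : X → ℝ) W ≤ R := (le_ciSup (bddAbove_mutualInfo hW hsym hs) Q).trans hR
  exact iInf₂_le_of_le W hW (iInf_le_of_le hI (condRelEntropy_self W Q).le)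

theorem spherePackingExponent_antitone (W : X → Y → ℝ) : Antitone (spherePackingExponent W) :=
  fun _ _ h => iSup_mono fun _ => iInf_mono fun _ => iInf_mono fun _ =>
    iInf_mono' fun hV => ⟨hV.trans h, le_rfl⟩

/-- Singularity collapses Gallager's sum to ∑ δ T^{1+ρ}, where T(y) is the Q-mass of the inputs
compatible with y. Bernoulli's inequality around T = β bounds it below by the Laplace transform plus
a linear term; that term vanishes because functions of β have the same mean under the output law δT
as under δβ. -/
theorem gallagerE0_le [Nonempty X] (hW : IsChannel W) (hsym : IsSymmetric W) (hs : IsSingular W)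
    {Q : X → ℝ} (hQ : Q ∈ stdSimplex ℝ X) {ρ : ℝ} (hρ : 0 ≤ ρ) :
    gallagerE0 W ρ Q ≤ -Real.log (laplace (uniformOut W) (infoDensity W) ρ) := by
  classical
  refine neg_le_neg (Real.log_le_log
    (laplace_pos (uniformOut_nonneg W) (sum_uniformOut hW hs) _ ρ) ?_)
  have hρ1 : 1 + ρ ≠ 0 := by positivity
  set T : Y → ℝ := fun y => ∑ x, Q x * if 0 < W x y then 1 else 0 with hT
  have hT0 : ∀ y, 0 ≤ T y := fun y =>
    Finset.sum_nonneg fun x _ => mul_nonneg (hQ.1 x) (by split_ifs <;> norm_num)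
  have hinner : ∀ y, (∑ x, Q x * W x y ^ (1 / (1 + ρ))) ^ (1 + ρ)
      = columnValue W y * T y ^ (1 + ρ) := by
    intro y
    have h1 : ∑ x, Q x * W x y ^ (1 / (1 + ρ)) = columnValue W y ^ (1 / (1 + ρ)) * T y := by
      rw [hT, Finset.mul_sum]
      refine Finset.sum_congr rfl fun x _ => ?_
      split_ifs with h
      · rw [hs.eq_columnValue h]; ring
      · rw [le_antisymm (not_lt.1 h) (hW.nonneg x y), Real.zero_rpow (by positivity)]
        ring
    rw [h1, Real.mul_rpow (Real.rpow_nonneg (columnValue_nonneg W y) _) (hT0 y),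
      ← Real.rpow_mul (columnValue_nonneg W y), one_div_mul_cancel hρ1, Real.rpow_one]
  simp only [hinner]
  set h : ℝ → ℝ := fun t => Real.exp (ρ * Real.log t) with hh
  have hJh : ∀ y, Real.exp (-(ρ * infoDensity W y)) = h (supportFrac W y) := fun y => by
    rw [hh, infoDensity]
    congr 1
    ring
  have hδT : ∀ y, columnValue W y * T y = outputDist Q W y := by
    intro y
    rw [hT, outputDist, Finset.mul_sum]
    refine Finset.sum_congr rfl fun x _ => ?_
    conv_rhs => rw [channel_eq_ite hW hs x y]
    ring
  have hbern : ∀ y, uniformOut W y * h (supportFrac W y)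
      + (1 + ρ) * (outputDist Q W y * h (supportFrac W y)
        - uniformOut W y * h (supportFrac W y)) ≤ columnValue W y * T y ^ (1 + ρ) := by
    intro y
    rcases (supportFrac_nonneg W y).eq_or_lt with h0 | h0
    · rw [← hδT, uniformOut, columnValue_eq_zero_of_supportFrac h0.symm]
      simp
    · set β := supportFrac W y
      have hpow : β ^ (1 + ρ) = β * h β := by
        rw [Real.rpow_add h0, Real.rpow_one, Real.rpow_def_of_pos h0, mul_comm (Real.log β)]
      have hb := one_add_mul_self_le_rpow_one_add (s := T y / β - 1) (p := 1 + ρ)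
        (by linarith [div_nonneg (hT0 y) h0.le]) (by linarith)
      rw [add_sub_cancel, Real.div_rpow (hT0 y) h0.le, le_div_iff₀ (Real.rpow_pos_of_pos h0 _),
        hpow] at hb
      have hb' := mul_le_mul_of_nonneg_left hb (columnValue_nonneg W y)
      refine le_trans (le_of_eq ?_) hb'
      rw [← hδT, uniformOut]
      change columnValue W y * β * h β
        + (1 + ρ) * (columnValue W y * T y * h β - columnValue W y * β * h β) = _
      field_simp
  have hsum := Finset.sum_le_sum fun y (_ : y ∈ Finset.univ) => hbern y
  rw [Finset.sum_add_distrib, ← Finset.mul_sum, Finset.sum_sub_distrib, sum_outputDist_mul] at hsum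
  have hout : ∑ x, ∑ y, Q x * W x y * h (supportFrac W y)
      = ∑ y, uniformOut W y * h (supportFrac W y) := by
    simp only [mul_assoc, ← Finset.mul_sum]
    rw [Finset.sum_congr rfl fun x _ => by rw [sum_channel_mul_supportFrac hW hsym hs h x],
      ← Finset.sum_mul, hQ.2, one_mul]
  rw [hout, sub_self, mul_zero, add_zero] at hsum
  simpa only [laplace, hJh] using hsum

theorem ofReal_sum_le {ι : Type*} (s : Finset ι) (f : ι → ℝ) :
    ENNReal.ofReal (∑ i ∈ s, f i) ≤ ∑ i ∈ s, ENNReal.ofReal (f i) :=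
  Finset.le_sum_of_subadditive _ ENNReal.ofReal_zero.le (fun _ _ => ENNReal.ofReal_add_le) _ _

/-- For uniform inputs, `D(V‖W|Q) + ρ I(Q;V)` is at least Gallager's function. -/
theorem neg_log_laplace_le [Nonempty X] (hW : IsChannel W) (hs : IsSingular W)
    {V : X → Y → ℝ} (hV : IsChannel V) (hVW : ∀ x y, W x y = 0 → V x y = 0) {Q : X → ℝ}
    (hQ : Q = fun _ => 1 / (Fintype.card X : ℝ)) {ρ : ℝ} (hρ : 0 ≤ ρ) :
    -Real.log (laplace (uniformOut W) (infoDensity W) ρ)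
      ≤ ∑ x, Q x * ∑ y, V x y * Real.log (V x y / W x y) + ρ * mutualInfo Q V := by
  classical
  have hcard : (0 : ℝ) < Fintype.card X := Nat.cast_pos.2 Fintype.card_pos
  have hQ0 : ∀ x, 0 < Q x := fun x => by rw [hQ]; positivity
  have hQ1 : ∑ x, Q x = 1 := by
    rw [hQ]
    simp [hcard.ne']
  set r := outputDist Q V with hr
  have hr0 : ∀ y, 0 ≤ r y := outputDist_nonneg (fun x => (hQ0 x).le) hV.nonneg
  have hr1 : ∑ y, r y = 1 := sum_outputDist hQ1 hV
  have hWpos : ∀ x y, 0 < V x y → 0 < W x y := fun x y h =>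
    (hW.nonneg x y).lt_of_ne' fun h0 => h.ne' (hVW x y h0)
  have hrpos : ∀ x y, 0 < V x y → 0 < r y := fun x y h =>
    (mul_pos (hQ0 x) h).trans_le (le_outputDist (fun x => (hQ0 x).le) hV.nonneg x y)
  have hrW : ∀ y, 0 < r y → ∃ x, 0 < W x y := fun y h => by
    obtain ⟨x, -, hx⟩ := Finset.exists_ne_zero_of_sum_ne_zero (ne_of_gt h)
    exact ⟨x, hWpos x y ((hV.nonneg x y).lt_of_ne' (right_ne_zero_of_mul hx))⟩
  -- the divergence splits into a mutual information and an output term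
  have hsplit : ∑ x, Q x * ∑ y, V x y * Real.log (V x y / W x y)
      = mutualInfo Q V + ∑ y, r y * Real.log (r y / columnValue W y) := by
    rw [sum_outputDist_mul, mutualInfo, ← Finset.sum_add_distrib]
    refine Finset.sum_congr rfl fun x _ => ?_
    rw [Finset.mul_sum, ← Finset.sum_add_distrib]
    refine Finset.sum_congr rfl fun y _ => ?_
    rcases (hV.nonneg x y).eq_or_lt with h | h
    · rw [← h]; ring
    · have h1 := hWpos x y h
      have h2 := hrpos x y h
      have h3 := columnValue_pos h1
      rw [← hr, hs.eq_columnValue h1, Real.log_div h.ne' h3.ne', Real.log_div h.ne' h2.ne',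
        Real.log_div h2.ne' h3.ne']
      ring
  -- the mutual information is at least the mean information density
  have hmi : ∑ y, r y * infoDensity W y ≤ mutualInfo Q V := by
    -- Gibbs' inequality against the joint law with output marginal r in which, given y, the input
    -- is uniform on the inputs compatible with y.
    have hterm : ∀ x y, Q x * V x y - Q x * (r y / supportFrac W y * if 0 < W x y then 1 else 0)
        ≤ Q x * V x y * Real.log (V x y / r y) - Q x * V x y * infoDensity W y := by
      intro x y
      rcases (hV.nonneg x y).eq_or_lt with h | h
      · rw [← h]
        simp only [mul_zero, zero_mul, zero_sub, sub_self, Left.neg_nonpos_iff]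
        refine mul_nonneg (hQ0 x).le (mul_nonneg (div_nonneg (hr0 y) (supportFrac_nonneg W y)) ?_)
        split_ifs <;> norm_num
      · have h1 := hWpos x y h
        have h2 := hrpos x y h
        have h3 := supportFrac_pos h1
        have h4 := sub_le_mul_log_div h.le (div_pos h2 h3).le fun _ => div_pos h2 h3
        rw [Real.log_div h.ne' (div_pos h2 h3).ne', Real.log_div h2.ne' h3.ne'] at h4
        rw [if_pos h1, mul_one, Real.log_div h.ne' h2.ne', infoDensity]
        have := mul_le_mul_of_nonneg_left h4 (hQ0 x).le
        linarith
    have hsum := Finset.sum_le_sum fun x (_ : x ∈ Finset.univ) =>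
      Finset.sum_le_sum fun y (_ : y ∈ Finset.univ) => hterm x y
    simp only [Finset.sum_sub_distrib] at hsum
    rw [← sum_outputDist_mul Q V (infoDensity W)] at hsum
    have e1 : ∑ x, ∑ y, Q x * V x y = 1 := by
      simp only [← Finset.mul_sum, hV.sum_eq_one, mul_one, hQ1]
    have e2 : ∑ x, ∑ y, Q x * (r y / supportFrac W y * if 0 < W x y then 1 else 0) ≤ 1 := by
      rw [Finset.sum_comm]
      refine le_trans (Finset.sum_le_sum fun y _ => ?_) hr1.le
      have : ∑ x, Q x * (r y / supportFrac W y * if 0 < W x y then 1 else 0)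
          = r y / supportFrac W y * supportFrac W y := by
        have hfr : supportFrac W y = ∑ x, Q x * if 0 < W x y then 1 else 0 := by
          rw [supportFrac, Finset.sum_div, hQ]
          refine Finset.sum_congr rfl fun x _ => ?_
          split_ifs <;> ring
        conv_rhs => rw [hfr, Finset.mul_sum, ← hfr]
        exact Finset.sum_congr rfl fun x _ => by ring
      rw [this]
      rcases (supportFrac_nonneg W y).eq_or_lt with h | h
      · rw [← h]
        simpa using hr0 y
      · rw [div_mul_cancel₀ _ h.ne']
    have e3 : ∑ x, ∑ y, Q x * V x y * Real.log (V x y / r y) = mutualInfo Q V := rfl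
    rw [e1, e3] at hsum
    linarith
  set Z := laplace (uniformOut W) (infoDensity W) ρ with hZ
  have hZ0 : 0 < Z := laplace_pos (uniformOut_nonneg W) (sum_uniformOut hW hs) _ ρ
  have hout : -Real.log Z
      ≤ ∑ y, r y * Real.log (r y / columnValue W y) + (1 + ρ) * ∑ y, r y * infoDensity W y := by
    -- Gibbs' inequality for r against the tilted output law q e^{−ρJ}/Z.
    have hterm : ∀ y, r y - uniformOut W y * Real.exp (-(ρ * infoDensity W y)) / Z
        - r y * Real.log Z
        ≤ r y * Real.log (r y / columnValue W y) + (1 + ρ) * (r y * infoDensity W y) := by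
      intro y
      rcases (hr0 y).eq_or_lt with h | h
      · rw [← h]
        have : 0 ≤ uniformOut W y * Real.exp (-(ρ * infoDensity W y)) / Z :=
          div_nonneg (mul_nonneg (uniformOut_nonneg W y) (Real.exp_pos _).le) hZ0.le
        simpa using this
      · obtain ⟨x, hx⟩ := hrW y h
        have h3 := supportFrac_pos hx
        have h4 := columnValue_pos hx
        have h5 : 0 < uniformOut W y := mul_pos h4 h3
        have h6 : 0 < uniformOut W y * Real.exp (-(ρ * infoDensity W y)) / Z := by positivity
        have h7 := sub_le_mul_log_div h.le h6.le fun _ => h6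
        rw [Real.log_div h.ne' h6.ne', Real.log_div (by positivity) hZ0.ne',
          Real.log_mul h5.ne' (Real.exp_pos _).ne', Real.log_exp, uniformOut,
          Real.log_mul h4.ne' h3.ne'] at h7
        rw [Real.log_div h.ne' h4.ne', infoDensity] at *
        rw [uniformOut]
        linarith
    have hsum := Finset.sum_le_sum fun y (_ : y ∈ Finset.univ) => hterm y
    rw [Finset.sum_sub_distrib, Finset.sum_sub_distrib, ← Finset.sum_mul, ← Finset.sum_div, hr1,
      Finset.sum_add_distrib, ← Finset.mul_sum] at hsum
    have : (∑ y, uniformOut W y * Real.exp (-(ρ * infoDensity W y))) / Z = 1 := div_self hZ0.ne'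
    rw [this] at hsum
    linarith
  rw [hsplit]
  have := mul_le_mul_of_nonneg_left hmi (show 0 ≤ 1 + ρ by linarith)
  linarith

/-- Weak Lagrange duality at the uniform input law, with multiplier ρ for the constraint on I(Q;V).
A channel V not dominated by W has infinite divergence, since uniform Q charges every input. -/
theorem ofReal_le_spherePackingExponent [Nonempty X] (hW : IsChannel W) (hs : IsSingular W)
    {ρ : ℝ} (hρ : 0 ≤ ρ) (R : ℝ) :
    ENNReal.ofReal (-Real.log (laplace (uniformOut W) (fun y => infoDensity W y - R) ρ))
      ≤ spherePackingExponent W R := by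
  have hcard : (0 : ℝ) < Fintype.card X := Nat.cast_pos.2 Fintype.card_pos
  set Q : X → ℝ := fun _ => 1 / (Fintype.card X : ℝ) with hQ
  have hQ0 : ∀ x, 0 < Q x := fun x => by rw [hQ]; positivity
  have hQs : Q ∈ stdSimplex ℝ X := ⟨fun x => (hQ0 x).le, by rw [hQ]; simp [hcard.ne']⟩
  refine le_trans ?_ (le_iSup (fun Q : stdSimplex ℝ X => spherePackingExponentAt W R (Q : X → ℝ))
    ⟨Q, hQs⟩)
  refine le_iInf fun V => le_iInf fun hV => le_iInf fun hI => ?_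
  change _ ≤ condRelEntropy V W Q
  by_cases hVW : ∀ x y, W x y = 0 → V x y = 0
  · have h1 := neg_log_laplace_le hW hs hV hVW hQ hρ
    have h2 : condRelEntropy V W Q
        = ∑ x, ENNReal.ofReal (Q x * ∑ y, V x y * Real.log (V x y / W x y)) := by
      refine Finset.sum_congr rfl fun x _ => ?_
      rw [relEntropy, if_pos (hVW x), ENNReal.ofReal_mul (hQ0 x).le]
    rw [h2]
    refine le_trans (ENNReal.ofReal_le_ofReal ?_) (ofReal_sum_le _ _)
    rw [laplace_sub_const, Real.log_mul (Real.exp_pos _).ne'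
      (laplace_pos (uniformOut_nonneg W) (sum_uniformOut hW hs) _ ρ).ne', Real.log_exp]
    have hI' : mutualInfo Q V ≤ R := hI
    have := mul_le_mul_of_nonneg_left hI' hρ
    linarith
  · push Not at hVW
    obtain ⟨x, y, h1, h2⟩ := hVW
    have htop : relEntropy (V x) (W x) = ⊤ := by
      rw [relEntropy, if_neg]
      exact fun h => h2 (h y h1)
    have hx : ENNReal.ofReal (Q x) * relEntropy (V x) (W x) = ⊤ := by
      rw [htop, ENNReal.mul_top]
      exact (ENNReal.ofReal_pos.2 (hQ0 x)).ne'
    refine le_trans le_top (hx.symm.le.trans ?_)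
    exact Finset.single_le_sum (f := fun x => ENNReal.ofReal (Q x) * relEntropy (V x) (W x))
      (fun _ _ => bot_le) (Finset.mem_univ x)

end Channel

section Codes

variable {X Y : Type*} {W : X → Y → ℝ}

/-! ### Output sequences -/

theorem prod_uniformOut [Fintype X] {N : ℕ} (W : X → Y → ℝ) (y : Fin N → Y) :
    ∏ n, uniformOut W (y n) = (∏ n, columnValue W (y n)) * ∏ n, supportFrac W (y n) :=
  Finset.prod_mul_distrib

theorem prod_supportFrac_nonneg [Fintype X] {N : ℕ} (W : X → Y → ℝ) (y : Fin N → Y) :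
    0 ≤ ∏ n, supportFrac W (y n) :=
  Finset.prod_nonneg fun _ _ => supportFrac_nonneg W _

theorem prod_columnValue_nonneg [Fintype X] {N : ℕ} (W : X → Y → ℝ) (y : Fin N → Y) :
    0 ≤ ∏ n, columnValue W (y n) :=
  Finset.prod_nonneg fun _ _ => columnValue_nonneg W _

theorem exp_neg_sum_infoDensity [Fintype X] {N : ℕ} {y : Fin N → Y} (h : 0 < ∏ n, supportFrac W
    (y n))
    (R : ℝ) : Real.exp (-∑ n, (infoDensity W (y n) - R))
      = Real.exp (N * R) * ∏ n, supportFrac W (y n) := by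
  have hpos : ∀ n, 0 < supportFrac W (y n) := fun n =>
    (supportFrac_nonneg W _).lt_of_ne' (Finset.prod_ne_zero_iff.1 h.ne' n (Finset.mem_univ n))
  rw [← Finset.prod_congr rfl fun n _ => exp_neg_infoDensity (hpos n), ← Real.exp_sum,
    ← Real.exp_add]
  congr 1
  simp only [Finset.sum_sub_distrib, Finset.sum_neg_distrib, Finset.sum_const, Finset.card_univ,
    Fintype.card_fin, nsmul_eq_mul]
  ring

/-- With feedback the last input depends on all earlier outputs, so induction must peel off the last
letter. -/
theorem seqExp_snoc {Ω : Type*} [Fintype Ω] {p : Ω → ℝ} {N : ℕ} (F : (Fin (N + 1) → Ω) → ℝ) :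
    seqExp p (N + 1) F
      = seqExp p N fun ω => ∑ a, p a * F (Fin.snoc (α := fun _ => Ω) ω a) := by
  unfold seqExp
  rw [← (Fin.snocEquiv fun _ : Fin (N + 1) => Ω).sum_comp, Fintype.sum_prod_type,
    Finset.sum_comm]
  refine Finset.sum_congr rfl fun ω _ => ?_
  rw [Finset.mul_sum]
  refine Finset.sum_congr rfl fun a _ => ?_
  simp [Fin.snocEquiv, Fin.prod_univ_castSucc, mul_assoc]

/-- The probability of the output sequence `y` when the inputs are chosen by `enc` with feedback. -/
def feedbackProb {N : ℕ} (W : X → Y → ℝ) (enc : (n : Fin N) → (Fin n → Y) → X) (y : Fin N → Y) :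
    ℝ :=
  ∏ n : Fin N, W (enc n fun i => y (Fin.castLE n.isLt.le i)) (y n)

/-- Even with feedback the law of the product of the support fractions along the output sequence
does not depend on the encoder. -/
theorem sum_feedbackProb_mul [Fintype X] [Fintype Y] (hW : IsChannel W) (hsym : IsSymmetric W)
    (hs : IsSingular W)
    {N : ℕ} (enc : (n : Fin N) → (Fin n → Y) → X) (h : ℝ → ℝ) :
    ∑ y, feedbackProb W enc y * h (∏ n, supportFrac W (y n))
      = seqExp (uniformOut W) N fun y => h (∏ n, supportFrac W (y n)) := by
  induction N generalizing h with
  | zero => simp [feedbackProb, seqExp]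
  | succ N ih =>
    rw [seqExp_snoc]
    simp only [Fin.prod_univ_castSucc, Fin.snoc_castSucc, Fin.snoc_last]
    -- Given the past, the last input is fixed and its output has an input-free law of β. Averaging
    -- over that output gives a new function of the product over the past, to which the induction
    -- hypothesis applies.
    rw [← ih (fun n => enc n.castSucc)
      fun t => ∑ a, uniformOut W a * h (t * supportFrac W a),
      ← (Fin.snocEquiv fun _ : Fin (N + 1) => Y).sum_comp, Fintype.sum_prod_type,
      Finset.sum_comm]
    refine Finset.sum_congr rfl fun y _ => ?_
    rw [← sum_channel_mul_supportFrac hW hsym hs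
      (fun t => h ((∏ n, supportFrac W (y n)) * t)) (enc (Fin.last N) y), Finset.mul_sum]
    refine Finset.sum_congr rfl fun a _ => ?_
    simp only [Fin.snocEquiv, Equiv.coe_fn_mk, Fin.snoc_castSucc, Fin.snoc_last, feedbackProb,
      Fin.prod_univ_castSucc]
    have hpast : ∀ n : Fin N, (fun i : Fin n => (Fin.snoc (α := fun _ => Y) y a : Fin (N + 1) → Y)
        (Fin.castLE n.castSucc.isLt.le i)) = fun i => y (Fin.castLE n.isLt.le i) := fun n =>
      funext fun i => Fin.snoc_castSucc (α := fun _ => Y) a y (Fin.castLE n.isLt.le i)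
    have hlast : (fun i : Fin N => (Fin.snoc (α := fun _ => Y) y a : Fin (N + 1) → Y)
        (Fin.castLE (Fin.last N).isLt.le i)) = y :=
      funext fun i => Fin.snoc_castSucc (α := fun _ => Y) a y i
    have hprod : ∏ n : Fin N, W (enc n.castSucc fun i =>
          (Fin.snoc (α := fun _ => Y) y a : Fin (N + 1) → Y)
            (Fin.castLE n.castSucc.isLt.le i)) (y n)
        = ∏ n : Fin N, W (enc n.castSucc fun i => y (Fin.castLE n.isLt.le i)) (y n) :=
      Finset.prod_congr rfl fun n _ =>
        congrArg (fun z => W (enc n.castSucc z) (y n)) (hpast n)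
    have hl : W (enc (Fin.last N) fun i => (Fin.snoc (α := fun _ => Y) y a : Fin (N + 1) → Y)
        (Fin.castLE (Fin.last N).isLt.le i)) a = W (enc (Fin.last N) y) a :=
      congrArg (fun z => W (enc (Fin.last N) z) a) hlast
    rw [hprod, hl, mul_assoc]
    rfl

theorem feedbackProb_nonneg [Fintype Y] (hW : IsChannel W) {N : ℕ} (enc : (n : Fin N) →
    (Fin n → Y) → X)
    (y : Fin N → Y) : 0 ≤ feedbackProb W enc y :=
  Finset.prod_nonneg fun _ _ => hW.nonneg _ _

theorem feedbackProb_le [Fintype X] [Fintype Y] (hW : IsChannel W) (hs : IsSingular W) {N : ℕ}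
    (enc : (n : Fin N) → (Fin n → Y) → X) (y : Fin N → Y) :
    feedbackProb W enc y ≤ ∏ n, columnValue W (y n) :=
  Finset.prod_le_prod (fun _ _ => hW.nonneg _ _) fun _ _ => channel_le_columnValue hW hs _ _

theorem numMessages_pos (N : ℕ) (R : ℝ) : 0 < numMessages N R :=
  Nat.ceil_pos.2 (Real.exp_pos _)

theorem exp_le_numMessages (N : ℕ) (R : ℝ) : Real.exp (N * R) ≤ numMessages N R := Nat.le_ceil _

theorem numMessages_le (N : ℕ) {R : ℝ} (hR : 0 ≤ R) :
    (numMessages N R : ℝ) ≤ 2 * Real.exp (N * R) := by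
  have h1 : (numMessages N R : ℝ) < Real.exp (N * R) + 1 := Nat.ceil_lt_add_one (Real.exp_pos _).le
  have h2 : 1 ≤ Real.exp (N * R) := Real.one_le_exp (by positivity)
  linarith

/-! ### The converse -/

theorem seqExp_le_avgError [Fintype X] [Fintype Y] (hW : IsChannel W) (hsym : IsSymmetric W)
    (hs : IsSingular W)
    {N : ℕ} {R : ℝ} (c : FeedbackCode X Y N R) :
    seqExp (uniformOut W) N (fun y => max 0 (1 - Real.exp (∑ n, (infoDensity W (y n) - R))))
      ≤ c.avgError W := by
  classical
  set M := numMessages N R with hM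
  have hM0 : (0 : ℝ) < M := Nat.cast_pos.2 (numMessages_pos N R)
  rw [FeedbackCode.avgError, le_div_iff₀ hM0]
  -- Errors are counted only where M ∏ β ≥ 1, that is, where the bound 1 − 1/(M ∏ β) is nonnegative.
  -- A function of ∏ β alone keeps the totals independent of the encoder.
  set h : ℝ → ℝ := fun t => if 1 ≤ M * t then 1 else 0 with hh
  have hh0 : ∀ t, 0 ≤ h t := fun t => by rw [hh]; dsimp only; split_ifs <;> norm_num
  have hh1 : ∀ t, h t ≤ 1 := fun t => by rw [hh]; dsimp only; split_ifs <;> norm_num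
  set P : Fin M → (Fin N → Y) → ℝ := fun m y => feedbackProb W (c.enc m) y with hP
  have hP0 : ∀ m y, 0 ≤ P m y := fun m y => feedbackProb_nonneg hW _ y
  set β : (Fin N → Y) → ℝ := fun y => ∏ n, supportFrac W (y n) with hβ
  set δ : (Fin N → Y) → ℝ := fun y => ∏ n, columnValue W (y n) with hδ
  have herr : ∀ m, ∑ y, P m y * h (β y) - ∑ y, (if c.dec y = m then P m y * h (β y) else 0)
      ≤ c.errorProb W m := by
    intro m
    rw [FeedbackCode.errorProb, Finset.sum_filter, ← Finset.sum_sub_distrib]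
    refine Finset.sum_le_sum fun y _ => ?_
    by_cases hd : c.dec y = m
    · simp [hd]
    · simp only [hd, if_false, sub_zero, ne_eq, not_false_eq_true, if_true]
      exact mul_le_of_le_one_right (hP0 m y) (hh1 _)
  have hsum := Finset.sum_le_sum fun m (_ : m ∈ Finset.univ) => herr m
  refine le_trans ?_ hsum
  rw [Finset.sum_sub_distrib, Finset.sum_comm (f := fun m y => if c.dec y = m then _ else _)]
  simp only [Finset.sum_ite_eq, Finset.mem_univ, if_true]
  have htot : ∀ m, ∑ y, P m y * h (β y) = ∑ y, δ y * β y * h (β y) := fun m => by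
    rw [sum_feedbackProb_mul hW hsym hs (c.enc m) h, seqExp]
    simp only [prod_uniformOut]
    rfl
  simp only [htot, Finset.sum_const, Finset.card_univ, Fintype.card_fin, nsmul_eq_mul]
  rw [seqExp, Finset.sum_mul, Finset.mul_sum, ← Finset.sum_sub_distrib]
  refine Finset.sum_le_sum fun y _ => ?_
  have hδ0 : 0 ≤ δ y := prod_columnValue_nonneg W y
  have hdec : P (c.dec y) y * h (β y) ≤ δ y * h (β y) :=
    mul_le_mul_of_nonneg_right (feedbackProb_le hW hs _ y) (hh0 _)
  refine le_trans ?_ (sub_le_sub_left hdec _)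
  rw [prod_uniformOut]
  change δ y * β y * _ * M ≤ M * (δ y * β y * h (β y)) - δ y * h (β y)
  rcases (prod_supportFrac_nonneg W y).eq_or_lt with h0 | h0
  · have hβ0 : β y = 0 := h0.symm
    have : h 0 = 0 := by rw [hh]; norm_num
    rw [hβ0, this]
    simp
  · have hβ0 : 0 < β y := h0
    have hexp := exp_neg_sum_infoDensity h0 R
    rw [Real.exp_neg, inv_eq_iff_eq_inv] at hexp
    rw [hexp]
    have hle : (Real.exp (N * R) * β y) ≤ M * β y :=
      mul_le_mul_of_nonneg_right (exp_le_numMessages N R) hβ0.le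
    have hinv : (M * β y)⁻¹ ≤ (Real.exp (N * R) * β y)⁻¹ := inv_anti₀ (by positivity) hle
    have hmain : max 0 (1 - (Real.exp (N * R) * β y)⁻¹) * (M * β y) ≤ (M * β y - 1) * h (β y) := by
      have hMβ : 0 < M * β y := by positivity
      rcases le_or_gt 1 (M * β y) with hc | hc
      · have h1 : h (β y) = 1 := if_pos hc
        rw [h1, mul_one]
        have h2 : max 0 (1 - (Real.exp (N * R) * β y)⁻¹) ≤ 1 - (M * β y)⁻¹ :=
          max_le (sub_nonneg.2 (inv_le_one_of_one_le₀ hc)) (sub_le_sub_left hinv _)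
        refine (mul_le_mul_of_nonneg_right h2 hMβ.le).trans (le_of_eq ?_)
        rw [sub_mul, one_mul, inv_mul_cancel₀ hMβ.ne']
      · have h1 : h (β y) = 0 := if_neg (not_le.2 hc)
        have h2 : 1 ≤ (Real.exp (N * R) * β y)⁻¹ :=
          (one_le_inv₀ (by positivity)).2 (hle.trans hc.le)
        rw [h1, mul_zero, max_eq_left (by linarith), zero_mul]
    have := mul_le_mul_of_nonneg_left hmain hδ0
    refine le_trans (le_of_eq ?_) (this.trans (le_of_eq ?_)) <;> ring

/-! ### Achievability -/

/-- The output sequence `y` can arise from the input sequence `a`. -/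
def Compatible (W : X → Y → ℝ) {N : ℕ} (a : Fin N → X) (y : Fin N → Y) : Prop :=
  ∀ n, 0 < W (a n) (y n)

theorem prod_channel_of_compatible [Fintype X] (hs : IsSingular W) {N : ℕ} {a : Fin N → X}
    {y : Fin N → Y}
    (h : Compatible W a y) : ∏ n, W (a n) (y n) = ∏ n, columnValue W (y n) :=
  Finset.prod_congr rfl fun n _ => hs.eq_columnValue (h n)

theorem prod_channel_of_not_compatible [Fintype Y] (hW : IsChannel W) {N : ℕ} {a : Fin N → X}
    {y : Fin N → Y} (h : ¬Compatible W a y) : ∏ n, W (a n) (y n) = 0 := by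
  unfold Compatible at h
  push Not at h
  obtain ⟨n, hn⟩ := h
  exact Finset.prod_eq_zero (Finset.mem_univ n) (le_antisymm hn (hW.nonneg _ _))

open Classical in
/-- Under the uniform output law, the event that one of `k ≤ M` given input sequences is compatible
with the output is bounded by the union bound, truncated at one. -/
theorem sum_uniformOut_compatible_le [Fintype X] [Fintype Y] (hW : IsChannel W)
    (hsym : IsSymmetric W)
    (hs : IsSingular W) {N : ℕ} (c : ℕ → Fin N → X) {k M : ℕ} (hk : k ≤ M) :
    seqExp (uniformOut W) N (fun y => if ∃ j < k, Compatible W (c j) y then 1 else 0)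
      ≤ seqExp (uniformOut W) N fun y => min 1 (M * ∏ n, supportFrac W (y n)) := by
  set h : ℝ → ℝ := fun t => if M * t ≤ 1 then 1 else 0 with hh
  have hh0 : ∀ t, 0 ≤ h t := fun t => by rw [hh]; dsimp only; split_ifs <;> norm_num
  -- On compatible outputs ∏ q = ∏ β · P(y | codeword), so this is a mean under the channel law of
  -- one codeword and hence does not depend on the codeword.
  have hone : ∀ j, seqExp (uniformOut W) N
      (fun y => h (∏ n, supportFrac W (y n)) * if Compatible W (c j) y then 1 else 0)
      = seqExp (uniformOut W) N fun y =>
        (∏ n, supportFrac W (y n)) * h (∏ n, supportFrac W (y n)) := by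
    intro j
    rw [← sum_feedbackProb_mul hW hsym hs (fun n _ => c j n) fun t => t * h t, seqExp]
    refine Finset.sum_congr rfl fun y _ => ?_
    rw [prod_uniformOut]
    change _ = (∏ n, W (c j n) (y n)) * _
    split_ifs with hc
    · rw [prod_channel_of_compatible hs hc]
      ring
    · rw [prod_channel_of_not_compatible hW hc]
      ring
  have hstep : seqExp (uniformOut W) N (fun y => if ∃ j < k, Compatible W (c j) y then 1 else 0)
      ≤ seqExp (uniformOut W) N (fun y => (1 - h (∏ n, supportFrac W (y n)))
        + ∑ j ∈ Finset.range k,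
          h (∏ n, supportFrac W (y n)) * if Compatible W (c j) y then 1 else 0) := by
    refine seqExp_mono (uniformOut_nonneg W) fun y => ?_
    have hnn : ∀ j, 0 ≤ h (∏ n, supportFrac W (y n)) * if Compatible W (c j) y then 1 else 0 :=
      fun j => mul_nonneg (hh0 _) (by split_ifs <;> norm_num)
    have hle1 : h (∏ n, supportFrac W (y n)) ≤ 1 := by
      rw [hh]; dsimp only; split_ifs <;> norm_num
    split_ifs with hex
    · obtain ⟨j, hj, hc⟩ := hex
      have := Finset.single_le_sum (f := fun j =>
        h (∏ n, supportFrac W (y n)) * if Compatible W (c j) y then (1 : ℝ) else 0)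
        (fun j _ => hnn j) (Finset.mem_range.2 hj)
      simp only [hc, if_true, mul_one] at this
      linarith
    · have := Finset.sum_nonneg fun j (_ : j ∈ Finset.range k) => hnn j
      linarith
  refine hstep.trans ?_
  have hsum : ∀ k : ℕ, seqExp (uniformOut W) N (fun y => ∑ j ∈ Finset.range k,
      h (∏ n, supportFrac W (y n)) * if Compatible W (c j) y then 1 else 0)
      = seqExp (uniformOut W) N fun y =>
        k * ((∏ n, supportFrac W (y n)) * h (∏ n, supportFrac W (y n))) := by
    intro k
    rw [seqExp_const_mul]
    induction k with
    | zero => simp [seqExp]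
    | succ k ih =>
      simp only [Finset.sum_range_succ, seqExp_add, ih, hone]
      push_cast
      ring
  rw [seqExp_add, hsum, ← seqExp_add]
  refine seqExp_mono (uniformOut_nonneg W) fun y => ?_
  set β := ∏ n, supportFrac W (y n)
  have hβ : 0 ≤ β := prod_supportFrac_nonneg W y
  have hkM : (k : ℝ) ≤ M := by exact_mod_cast hk
  rcases le_or_gt (M * β) 1 with hc | hc
  · have h1 : h β = 1 := if_pos hc
    rw [h1, min_eq_right hc]
    have := mul_le_mul_of_nonneg_right hkM hβ
    linarith
  · have h1 : h β = 0 := if_neg (not_le.2 hc)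
    rw [h1, min_eq_left hc.le]
    linarith

open Classical in
/-- Some input sequence is rarely confused with `k ≤ M` given ones. -/
theorem exists_input_of_compatible [Fintype X] [Fintype Y] [Nonempty X] (hW : IsChannel W)
    (hsym : IsSymmetric W)
    (hs : IsSingular W) {N : ℕ} (c : ℕ → Fin N → X) {k M : ℕ} (hk : k ≤ M) :
    ∃ a : Fin N → X,
      ∑ y : Fin N → Y, (∏ n, W (a n) (y n)) * (if ∃ j < k, Compatible W (c j) y then 1 else 0)
        ≤ seqExp (uniformOut W) N fun y => min 1 (M * ∏ n, supportFrac W (y n)) := by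
  have hcard : (0 : ℝ) < Fintype.card X := Nat.cast_pos.2 Fintype.card_pos
  set E := seqExp (uniformOut W) N fun y => min 1 (M * ∏ n, supportFrac W (y n)) with hE
  have hout : ∀ y : Fin N → Y, ∑ a : Fin N → X, ∏ n, W (a n) (y n)
      = (Fintype.card X : ℝ) ^ N * ∏ n, uniformOut W (y n) := by
    intro y
    have h1 := Finset.prod_univ_sum (fun _ : Fin N => (Finset.univ : Finset X))
      fun n x => W x (y n)
    rw [Fintype.piFinset_univ] at h1
    rw [← h1]
    simp only [uniformOut_eq hW hs, Finset.prod_div_distrib, Finset.prod_const, Finset.card_univ,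
      Fintype.card_fin]
    field_simp
  -- Random coding: uniform averaging over all input sequences turns the channel law into the
  -- product of q.
  have htot : ∑ a : Fin N → X, ∑ y : Fin N → Y,
      (∏ n, W (a n) (y n)) * (if ∃ j < k, Compatible W (c j) y then 1 else 0)
      ≤ ∑ _a : Fin N → X, E := by
    rw [Finset.sum_comm]
    simp only [← Finset.sum_mul, hout, mul_assoc, ← Finset.mul_sum]
    rw [Finset.sum_const, Finset.card_univ, Fintype.card_fun, Fintype.card_fin, nsmul_eq_mul]
    push_cast
    exact mul_le_mul_of_nonneg_left (sum_uniformOut_compatible_le hW hsym hs c hk)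
      (by positivity)
  obtain ⟨a, -, ha⟩ := Finset.exists_le_of_sum_le Finset.univ_nonempty htot
  exact ⟨a, ha⟩

open Classical in
/-- Greedy choice of codewords. -/
theorem exists_codebook [Fintype X] [Fintype Y] [Nonempty X] (hW : IsChannel W)
    (hsym : IsSymmetric W)
    (hs : IsSingular W) (N M : ℕ) :
    ∃ c : ℕ → Fin N → X, ∀ m < M,
      ∑ y : Fin N → Y, (∏ n, W (c m n) (y n)) * (if ∃ j < m, Compatible W (c j) y then 1 else 0)
        ≤ seqExp (uniformOut W) N fun y => min 1 (M * ∏ n, supportFrac W (y n)) := by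
  have key : ∀ k ≤ M, ∃ c : ℕ → Fin N → X, ∀ m < k,
      ∑ y : Fin N → Y, (∏ n, W (c m n) (y n)) * (if ∃ j < m, Compatible W (c j) y then 1 else 0)
        ≤ seqExp (uniformOut W) N fun y => min 1 (M * ∏ n, supportFrac W (y n)) := by
    intro k
    induction k with
    | zero => exact fun _ => ⟨fun _ _ => Classical.arbitrary X, fun m h => absurd h m.not_lt_zero⟩
    | succ k ih =>
      intro hk
      obtain ⟨c, hc⟩ := ih (by omega)
      obtain ⟨a, ha⟩ := exists_input_of_compatible hW hsym hs c (k := k) (M := M) (by omega)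
      refine ⟨Function.update c k a, fun m hm => ?_⟩
      have hpast : ∀ y, (∃ j < m, Compatible W (Function.update c k a j) y)
          ↔ ∃ j < m, Compatible W (c j) y := fun y =>
        exists_congr fun j => and_congr_right fun hj => by
          rw [Function.update_of_ne (by omega)]
      simp only [hpast]
      rcases Nat.lt_succ_iff_lt_or_eq.1 hm with h | rfl
      · rw [Function.update_of_ne (by omega)]
        exact hc m h
      · rw [Function.update_self]
        exact ha
  exact key M le_rfl

/-- The decoder takes the first compatible codeword, so message m fails only if an earlier codeword
is compatible. The greedy codebook controls this for each m separately, which gives maximal rather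
than average error. -/
theorem exists_code_maxError_le [Fintype X] [Fintype Y] [Nonempty X] (hW : IsChannel W)
    (hsym : IsSymmetric W)
    (hs : IsSingular W) (N : ℕ) (R : ℝ) :
    ∃ c : Code X Y N R, c.maxError W
      ≤ seqExp (uniformOut W) N fun y => min 1 (numMessages N R * ∏ n, supportFrac W (y n)) := by
  classical
  have hM := numMessages_pos N R
  have : Nonempty (Fin (numMessages N R)) := ⟨⟨0, hM⟩⟩
  obtain ⟨c, hc⟩ := exists_codebook hW hsym hs N (numMessages N R)
  have hdec : ∀ y : Fin N → Y, ∃ d : Fin (numMessages N R), ∀ m : Fin (numMessages N R),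
      Compatible W (c m) y → d ≠ m → ∃ j < (m : ℕ), Compatible W (c j) y := by
    intro y
    by_cases hex : ∃ j, j < numMessages N R ∧ Compatible W (c j) y
    · refine ⟨⟨Nat.find hex, (Nat.find_spec hex).1⟩, fun m hm hne => ?_⟩
      refine ⟨Nat.find hex, lt_of_le_of_ne (Nat.find_min' hex ⟨m.2, hm⟩) fun h => ?_,
        (Nat.find_spec hex).2⟩
      exact hne (Fin.ext h)
    -- The default message is harmless: outputs compatible with no codeword have probability zero
    -- under every message.
    · exact ⟨⟨0, hM⟩, fun m hm _ => absurd ⟨m, m.2, hm⟩ hex⟩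
  choose dec hd using hdec
  refine ⟨⟨fun m => c m, dec⟩, ciSup_le fun m => ?_⟩
  refine le_trans ?_ (hc m m.2)
  rw [Code.errorProb, Finset.sum_filter]
  refine Finset.sum_le_sum fun y _ => ?_
  by_cases hcomp : Compatible W (c m) y
  · have hnn : 0 ≤ ∏ n, W (c m n) (y n) := Finset.prod_nonneg fun _ _ => hW.nonneg _ _
    by_cases hne : dec y ≠ m
    · rw [if_pos hne, if_pos (hd y m hcomp hne), mul_one]
    · rw [if_neg hne]
      exact mul_nonneg hnn (by split_ifs <;> norm_num)
  · change (if dec y ≠ m then ∏ n, W (c m n) (y n) else 0) ≤ _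
    rw [prod_channel_of_not_compatible hW hcomp]
    simp

/-- The factor 2 absorbs the rounding up of e^{NR}, which is at least 1 because R ≥ 0. -/
theorem seqExp_min_numMessages_le [Fintype X] [Fintype Y] (W : X → Y → ℝ) (N : ℕ) {R : ℝ}
    (hR : 0 ≤ R) :
    seqExp (uniformOut W) N (fun y => min 1 (numMessages N R * ∏ n, supportFrac W (y n)))
      ≤ 2 * seqExp (uniformOut W) N
        fun y => min 1 (Real.exp (-∑ n, (infoDensity W (y n) - R))) := by
  rw [← seqExp_const_mul]
  refine Finset.sum_le_sum fun y _ => ?_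
  rcases (prod_supportFrac_nonneg W y).eq_or_lt with h | h
  · rw [prod_uniformOut, ← h]
    simp
  · refine mul_le_mul_of_nonneg_left ?_ (Finset.prod_nonneg fun _ _ => uniformOut_nonneg W _)
    dsimp only
    rw [exp_neg_sum_infoDensity h]
    have h1 := mul_le_mul_of_nonneg_right (numMessages_le N hR) h.le
    have h2 : 0 ≤ Real.exp (N * R) * ∏ n, supportFrac W (y n) := by positivity
    rcases le_total 1 (Real.exp (N * R) * ∏ n, supportFrac W (y n)) with hc | hc
    · rw [min_eq_left hc]
      exact (min_le_left _ _).trans (by norm_num)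
    · rw [min_eq_right hc]
      exact (min_le_right _ _).trans (by linarith)

/-! ### Comparison of the optimal error probabilities -/

theorem FeedbackCode.errorProb_nonneg [Fintype Y] (hW : IsChannel W) {N : ℕ} {R : ℝ}
    (c : FeedbackCode X Y N R) (m : Fin (numMessages N R)) : 0 ≤ c.errorProb W m :=
  Finset.sum_nonneg fun _ _ => Finset.prod_nonneg fun _ _ => hW.nonneg _ _

theorem FeedbackCode.avgError_nonneg [Fintype Y] (hW : IsChannel W) {N : ℕ} {R : ℝ}
    (c : FeedbackCode X Y N R) : 0 ≤ c.avgError W :=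
  div_nonneg (Finset.sum_nonneg fun m _ => c.errorProb_nonneg hW m) (Nat.cast_nonneg _)

theorem Code.errorProb_nonneg [Fintype Y] (hW : IsChannel W) {N : ℕ} {R : ℝ}
    (c : Code X Y N R) (m : Fin (numMessages N R)) : 0 ≤ c.errorProb W m :=
  Finset.sum_nonneg fun _ _ => Finset.prod_nonneg fun _ _ => hW.nonneg _ _

theorem Code.maxError_nonneg [Fintype Y] (hW : IsChannel W) {N : ℕ} {R : ℝ} (c : Code X Y N R) :
    0 ≤ c.maxError W :=
  Real.iSup_nonneg fun m => c.errorProb_nonneg hW m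

/-- A code without feedback, as a feedback code. -/
def Code.toFeedbackCode {X Y : Type*} {N : ℕ} {R : ℝ} (c : Code X Y N R) : FeedbackCode X Y N R where
  enc m n _ := c.enc m n
  dec := c.dec

theorem Code.avgError_toFeedbackCode_le [Fintype Y] (W : X → Y → ℝ) {N : ℕ} {R : ℝ}
    (c : Code X Y N R) :
    c.toFeedbackCode.avgError W ≤ c.maxError W := by
  have hM : (0 : ℝ) < numMessages N R := Nat.cast_pos.2 (numMessages_pos N R)
  rw [FeedbackCode.avgError, div_le_iff₀ hM]
  have h : ∀ m ∈ Finset.univ, c.toFeedbackCode.errorProb W m ≤ c.maxError W := fun m _ =>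
    le_ciSup (f := fun m => c.errorProb W m) (Set.finite_range _).bddAbove m
  refine (Finset.sum_le_sum h).trans (le_of_eq ?_)
  rw [Finset.sum_const, Finset.card_univ, Fintype.card_fin, nsmul_eq_mul, mul_comm]

theorem nonempty_code [Nonempty X] (N : ℕ) (R : ℝ) : Nonempty (Code X Y N R) :=
  ⟨⟨fun _ _ => Classical.arbitrary X, fun _ => ⟨0, numMessages_pos N R⟩⟩⟩

theorem minAvgErrorFeedback_le_minMaxError [Fintype Y] [Nonempty X] (hW : IsChannel W) (N : ℕ)
    (R : ℝ) :
    minAvgErrorFeedback W N R ≤ minMaxError W N R := by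
  have : Nonempty (Code X Y N R) := nonempty_code N R
  refine le_ciInf fun c => ?_
  exact (ciInf_le ⟨0, by rintro _ ⟨c, rfl⟩; exact c.avgError_nonneg hW⟩ c.toFeedbackCode).trans
    (c.avgError_toFeedbackCode_le W)

theorem minMaxError_le [Fintype X] [Fintype Y] [Nonempty X] (hW : IsChannel W)
    (hsym : IsSymmetric W)
    (hs : IsSingular W) (N : ℕ) {R : ℝ} (hR : 0 ≤ R) :
    minMaxError W N R ≤ 2 * seqExp (uniformOut W) N
      fun y => min 1 (Real.exp (-∑ n, (infoDensity W (y n) - R))) := by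
  obtain ⟨c, hc⟩ := exists_code_maxError_le hW hsym hs N R
  exact (ciInf_le ⟨0, by rintro _ ⟨c, rfl⟩; exact c.maxError_nonneg hW⟩ c).trans
    (hc.trans (seqExp_min_numMessages_le W N hR))

theorem le_minAvgErrorFeedback [Fintype X] [Fintype Y] [Nonempty X] (hW : IsChannel W)
    (hsym : IsSymmetric W)
    (hs : IsSingular W) (N : ℕ) (R : ℝ) :
    seqExp (uniformOut W) N (fun y => max 0 (1 - Real.exp (∑ n, (infoDensity W (y n) - R))))
      ≤ minAvgErrorFeedback W N R := by
  have : Nonempty (FeedbackCode X Y N R) := (nonempty_code N R).map Code.toFeedbackCode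
  exact le_ciInf fun c => seqExp_le_avgError hW hsym hs c

end Codes

section Exponents

variable {X Y : Type*} [Fintype X] [Fintype Y] {W : X → Y → ℝ}

/-! ### The exponents and the saddle point -/

/-- If E_SP were infinite at some R' strictly between, monotonicity would put R' in the set defining
R_∞. That set is bounded because E_SP vanishes from the capacity on. -/
theorem exists_ne_top_of_rateInfty_lt (hW : IsChannel W) (hsym : IsSymmetric W)
    (hs : IsSingular W) {R : ℝ} (hR : rateInfty W < R) :
    ∃ R' < R, spherePackingExponent W R' ≠ ⊤ := by
  obtain ⟨R', h1, h2⟩ := exists_between hR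
  refine ⟨R', h2, fun htop => absurd h1 (not_lt.2 ?_)⟩
  have h0 : 0 ≤ rateInfty W := Real.sSup_nonneg fun r hr => hr.1
  refine le_csSup ⟨max (capacity W) 0, ?_⟩
    ⟨h0.trans h1.le, fun r _ hr => top_le_iff.1 (htop ▸ spherePackingExponent_antitone W hr.le)⟩
  rintro r ⟨-, hr⟩
  by_contra hcon
  have := hr _ (le_max_right _ _) (not_le.1 hcon)
  rw [spherePackingExponent_eq_zero hW hsym hs (le_max_left _ _)] at this
  exact ENNReal.zero_ne_top this

variable [Nonempty X]

theorem sum_uniformOut_mul_pos (hW : IsChannel W) (hsym : IsSymmetric W) (hs : IsSingular W)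
    {R : ℝ} (hR : R < capacity W) : 0 < ∑ y, uniformOut W y * (infoDensity W y - R) := by
  simp only [mul_sub, Finset.sum_sub_distrib, ← Finset.sum_mul, sum_uniformOut hW hs, one_mul]
  exact sub_pos.2 (hR.trans_le (capacity_le hW hsym hs))

theorem laplace_infoDensity_pos (hW : IsChannel W) (hs : IsSingular W) (R ρ : ℝ) :
    0 < laplace (uniformOut W) (fun y => infoDensity W y - R) ρ :=
  laplace_pos (uniformOut_nonneg W) (sum_uniformOut hW hs) _ ρ

theorem gallagerE0_sub_le (hW : IsChannel W) (hsym : IsSymmetric W) (hs : IsSingular W)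
    {Q : X → ℝ} (hQ : Q ∈ stdSimplex ℝ X) {ρ : ℝ} (hρ : 0 ≤ ρ) (R : ℝ) :
    gallagerE0 W ρ Q - ρ * R
      ≤ -Real.log (laplace (uniformOut W) (fun y => infoDensity W y - R) ρ) := by
  have h := gallagerE0_le hW hsym hs hQ hρ
  rw [laplace_sub_const, Real.log_mul (Real.exp_pos _).ne'
    (laplace_pos (uniformOut_nonneg W) (sum_uniformOut hW hs) _ ρ).ne', Real.log_exp]
  linarith

/-- The bound −log λ(ρ) does not involve Q, so minimising λ over the compact interval [0,1] handles
both suprema, and also supplies the boundedness that real suprema require. -/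
theorem exists_randomCodingExponent_le (hW : IsChannel W) (hsym : IsSymmetric W)
    (hs : IsSingular W) (R : ℝ) :
    0 ≤ randomCodingExponent W R ∧ ∃ ρ ∈ Set.Icc (0 : ℝ) 1, randomCodingExponent W R
      ≤ -Real.log (laplace (uniformOut W) (fun y => infoDensity W y - R) ρ) := by
  have hne : Nonempty (stdSimplex ℝ X) := nonempty_stdSimplex
  obtain ⟨ρ, hρ, hmin⟩ := isCompact_Icc.exists_isMinOn (Set.nonempty_Icc.2 (zero_le_one' ℝ))
    (continuous_laplace (uniformOut W) fun y => infoDensity W y - R).continuousOn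
  have hbound : ∀ (Q : stdSimplex ℝ X) (t : Set.Icc (0 : ℝ) 1), gallagerE0 W t Q - t * R
      ≤ -Real.log (laplace (uniformOut W) (fun y => infoDensity W y - R) ρ) := fun Q t =>
    (gallagerE0_sub_le hW hsym hs Q.2 t.2.1 R).trans
      (neg_le_neg (Real.log_le_log (laplace_infoDensity_pos hW hs R ρ) (hmin t.2)))
  have hat : ∀ Q : stdSimplex ℝ X, randomCodingExponentAt W R Q
      ≤ -Real.log (laplace (uniformOut W) (fun y => infoDensity W y - R) ρ) := fun Q => by
    have : Nonempty (Set.Icc (0 : ℝ) 1) := ⟨⟨0, by simp⟩⟩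
    exact ciSup_le (hbound Q)
  refine ⟨?_, ρ, hρ, ciSup_le hat⟩
  obtain ⟨Q⟩ := hne
  have h0 : gallagerE0 W (0 : ℝ) Q - 0 * R = 0 := by
    have : ∑ y, ∑ x, (Q : X → ℝ) x * W x y = 1 := sum_outputDist Q.2.2 hW
    simp [gallagerE0, this]
  refine le_trans ?_ (le_ciSup ⟨_, by rintro _ ⟨Q, rfl⟩; exact hat Q⟩ Q)
  exact h0.symm.le.trans
    (le_ciSup (f := fun t : Set.Icc (0 : ℝ) 1 => gallagerE0 W t Q - t * R)
      ⟨_, by rintro _ ⟨t, rfl⟩; exact hbound Q t⟩ ⟨0, by simp⟩)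

/-- Where the two exponents agree, the saddle point lies in `[0, 1]`. -/
theorem exists_isMin_of_exponents_eq (hW : IsChannel W) (hsym : IsSymmetric W)
    (hs : IsSingular W) {R : ℝ}
    (h : ENNReal.ofReal (randomCodingExponent W R) = spherePackingExponent W R) :
    ∃ ρ ∈ Set.Icc (0 : ℝ) 1,
      (∀ t, 0 ≤ t → laplace (uniformOut W) (fun y => infoDensity W y - R) ρ
        ≤ laplace (uniformOut W) (fun y => infoDensity W y - R) t) ∧
      randomCodingExponent W R
        ≤ -Real.log (laplace (uniformOut W) (fun y => infoDensity W y - R) ρ) := by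
  obtain ⟨hnn, ρ, hρ, hle⟩ := exists_randomCodingExponent_le hW hsym hs R
  refine ⟨ρ, hρ, fun t ht => ?_, hle⟩
  have h1 := ofReal_le_spherePackingExponent hW hs ht R
  rw [← h, ENNReal.ofReal_le_ofReal_iff hnn] at h1
  exact (Real.log_le_log_iff (laplace_infoDensity_pos hW hs R ρ)
    (laplace_infoDensity_pos hW hs R t)).1 (by linarith)

/-- If the sphere-packing exponent is finite at some smaller rate, then there is a saddle point. -/
theorem exists_isMin_of_ne_top (hW : IsChannel W) (hs : IsSingular W) {R' R : ℝ} (hR : R' < R)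
    (h : spherePackingExponent W R' ≠ ⊤) :
    ∃ ρ, 0 ≤ ρ ∧ ∀ t, 0 ≤ t → laplace (uniformOut W) (fun y => infoDensity W y - R) ρ
      ≤ laplace (uniformOut W) (fun y => infoDensity W y - R) t := by
  set E := (spherePackingExponent W R').toReal with hE
  have hE0 : 0 ≤ E := ENNReal.toReal_nonneg
  have hd : 0 < R - R' := sub_pos.2 hR
  -- Beyond T the minimum cannot lie: log λ at rate R exceeds log λ at rate R' by t(R − R'), and the
  -- latter is at least −E. So λ ≥ 1 = λ(0) there.
  set T := E / (R - R') with hT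
  have hT0 : 0 ≤ T := by positivity
  obtain ⟨ρ, hρ, hmin⟩ := isCompact_Icc.exists_isMinOn (Set.nonempty_Icc.2 hT0)
    (continuous_laplace (uniformOut W) fun y => infoDensity W y - R).continuousOn
  refine ⟨ρ, hρ.1, fun t ht => ?_⟩
  rcases le_total t T with htT | htT
  · exact hmin ⟨ht, htT⟩
  · have h0 := hmin (Set.left_mem_Icc.2 hT0)
    rw [Set.mem_ofPred_eq, laplace_zero (sum_uniformOut hW hs)] at h0
    refine h0.trans ?_
    have h1 := (ENNReal.ofReal_le_iff_le_toReal h).1 (ofReal_le_spherePackingExponent hW hs ht R')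
    have hpos := laplace_pos (uniformOut_nonneg W) (sum_uniformOut hW hs) (infoDensity W) t
    rw [laplace_sub_const, Real.log_mul (Real.exp_pos _).ne' hpos.ne', Real.log_exp] at h1
    rw [← Real.log_nonneg_iff (laplace_infoDensity_pos hW hs R t), laplace_sub_const,
      Real.log_mul (Real.exp_pos _).ne' hpos.ne', Real.log_exp]
    have h2 : E ≤ t * (R - R') := (div_le_iff₀ hd).1 htT
    linarith

/-- The saddle point strictly decreases in the rate. -/
theorem saddle_lt {Ω : Type*} [Fintype Ω] {q J : Ω → ℝ} (hq : ∀ ω, 0 ≤ q ω) (hq1 : ∑ ω, q ω = 1)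
    {R' R ρ' ρ : ℝ} (hR : R' < R) (hρ' : 0 ≤ ρ') (hρ : 0 ≤ ρ)
    (hmin' : ∀ t, 0 ≤ t → laplace q (fun ω => J ω - R') ρ' ≤ laplace q (fun ω => J ω - R') t)
    (hmin : ∀ t, 0 ≤ t → laplace q (fun ω => J ω - R) ρ ≤ laplace q (fun ω => J ω - R) t)
    (hcrit' : ∑ ω, q ω * Real.exp (-(ρ' * (J ω - R'))) * (J ω - R') = 0)
    (hcrit : ∑ ω, q ω * Real.exp (-(ρ * (J ω - R))) * (J ω - R) = 0) : ρ < ρ' := by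
  refine lt_of_le_of_ne ?_ ?_
  -- In the sum of the two optimality inequalities the log-Laplace terms of J cancel, leaving (R −
  -- R')(ρ − ρ') ≤ 0.
  · have h1 := hmin' ρ hρ
    have h2 := hmin ρ' hρ'
    have hZ := laplace_pos hq hq1 J ρ
    have hZ' := laplace_pos hq hq1 J ρ'
    simp only [laplace_sub_const] at h1 h2
    rw [← Real.log_le_log_iff (by positivity) (by positivity),
      Real.log_mul (Real.exp_pos _).ne' (by positivity),
      Real.log_mul (Real.exp_pos _).ne' (by positivity), Real.log_exp, Real.log_exp] at h1 h2
    nlinarith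
  · rintro rfl
    -- At a common ρ both tilted laws coincide, and one law cannot give J both means R and R'.
    have h : ∑ ω, q ω * Real.exp (-(ρ * (J ω - R'))) * (J ω - R')
        = Real.exp (ρ * (R' - R)) * (∑ ω, q ω * Real.exp (-(ρ * (J ω - R))) * (J ω - R)
          + (R - R') * laplace q (fun ω => J ω - R) ρ) := by
      rw [laplace, Finset.mul_sum, ← Finset.sum_add_distrib, Finset.mul_sum]
      refine Finset.sum_congr rfl fun ω _ => ?_
      rw [show -(ρ * (J ω - R')) = ρ * (R' - R) + -(ρ * (J ω - R)) by ring, Real.exp_add]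
      ring
    rw [hcrit', hcrit, zero_add] at h
    have := mul_pos (Real.exp_pos (ρ * (R' - R)))
      (mul_pos (sub_pos.2 hR) (laplace_pos hq hq1 (fun ω => J ω - R) ρ))
    linarith

theorem pow_eq_exp_mul_log {t : ℝ} (ht : 0 < t) (N : ℕ) : t ^ N = Real.exp (N * Real.log t) := by
  rw [Real.exp_nat_mul, Real.exp_log ht]

/-! ### The two bounds -/

theorem exists_le_minAvgErrorFeedback (hW : IsChannel W) (hsym : IsSymmetric W)
    (hs : IsSingular W) {R' R : ℝ} (hR : R' < R) (hRC : R < capacity W)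
    (h : spherePackingExponent W R' ≠ ⊤) :
    spherePackingExponent W R ≠ ⊤ ∧ ∃ K : ℝ, 0 < K ∧ ∀ N : ℕ, 1 ≤ N →
      K / Real.sqrt N * Real.exp (-N * (spherePackingExponent W R).toReal)
        ≤ minAvgErrorFeedback W N R := by
  have hfin : spherePackingExponent W R ≠ ⊤ :=
    ne_top_of_le_ne_top h (spherePackingExponent_antitone W hR.le)
  have hmean := sum_uniformOut_mul_pos hW hsym hs hRC
  obtain ⟨ρ, hρ0, hmin⟩ := exists_isMin_of_ne_top hW hs hR h
  obtain ⟨hρ, hcrit⟩ := critical_of_isMin_laplace hmean hρ0 hmin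
  obtain ⟨K, hK, hKN⟩ :=
    le_seqExp_max (uniformOut_nonneg W) (sum_uniformOut hW hs) hmean hρ hcrit
  refine ⟨hfin, K, hK, fun N hN => ?_⟩
  refine le_trans ?_ ((hKN N hN).trans (le_minAvgErrorFeedback hW hsym hs N R))
  refine mul_le_mul_of_nonneg_left ?_ (by positivity)
  rw [pow_eq_exp_mul_log (laplace_infoDensity_pos hW hs R ρ)]
  refine Real.exp_le_exp.2 ?_
  have h1 := (ENNReal.ofReal_le_iff_le_toReal hfin).1
    (ofReal_le_spherePackingExponent hW hs hρ0 R)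
  have h2 := mul_le_mul_of_nonneg_left h1 (Nat.cast_nonneg (α := ℝ) N)
  linarith

/-- Agreement of the exponents at R alone gives only ρ ≤ 1. The auxiliary rate R' has a saddle point
ρ' ≤ 1 with ρ < ρ', which supplies the strict inequality needed for two-sided decay. -/
theorem exists_minMaxError_le (hW : IsChannel W) (hsym : IsSymmetric W) (hs : IsSingular W)
    {R' R : ℝ} (hR'0 : 0 ≤ R') (hR : R' < R) (hRC : R < capacity W)
    (h' : ENNReal.ofReal (randomCodingExponent W R') = spherePackingExponent W R')
    (h : ENNReal.ofReal (randomCodingExponent W R) = spherePackingExponent W R) :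
    ∃ K : ℝ, 0 < K ∧ ∀ N : ℕ, 1 ≤ N →
      minMaxError W N R ≤ K / Real.sqrt N * Real.exp (-N * randomCodingExponent W R) := by
  have hmean := sum_uniformOut_mul_pos hW hsym hs hRC
  have hq := sum_uniformOut hW hs
  obtain ⟨ρ', hρ', hmin', -⟩ := exists_isMin_of_exponents_eq hW hsym hs h'
  obtain ⟨ρ, hρ, hmin, hE⟩ := exists_isMin_of_exponents_eq hW hsym hs h
  obtain ⟨-, hcrit'⟩ := critical_of_isMin_laplace
    (sum_uniformOut_mul_pos hW hsym hs (hR.trans hRC)) hρ'.1 hmin'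
  obtain ⟨hρ0, hcrit⟩ := critical_of_isMin_laplace hmean hρ.1 hmin
  have hlt := saddle_lt (uniformOut_nonneg W) hq hR hρ'.1 hρ.1 hmin' hmin hcrit' hcrit
  obtain ⟨K, hK, hKN⟩ :=
    seqExp_min_le (uniformOut_nonneg W) hq hmean hρ0 (hlt.trans_le hρ'.2) hcrit
  refine ⟨2 * K, by positivity, fun N hN => ?_⟩
  refine (minMaxError_le hW hsym hs N (hR'0.trans hR.le)).trans ?_
  refine (mul_le_mul_of_nonneg_left (hKN N hN) zero_le_two).trans ?_
  rw [← mul_assoc, mul_div_assoc]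
  refine mul_le_mul_of_nonneg_left ?_ (by positivity)
  rw [pow_eq_exp_mul_log (laplace_infoDensity_pos hW hs R ρ)]
  refine Real.exp_le_exp.2 ?_
  have h2 := mul_le_mul_of_nonneg_left hE (Nat.cast_nonneg (α := ℝ) N)
  linarith

/-! ### The critical rates -/

/-- At these rates e^t ≥ 1 + t gives λ(ρ) ≥ 1. Together with the vanishing of E_SP this shows that
the set defining the critical rate is nonempty. -/
theorem randomCodingExponent_eq_zero (hW : IsChannel W) (hsym : IsSymmetric W)
    (hs : IsSingular W) {R : ℝ} (hR : ∑ y, uniformOut W y * infoDensity W y ≤ R) :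
    randomCodingExponent W R = 0 := by
  obtain ⟨hnn, ρ, hρ, hle⟩ := exists_randomCodingExponent_le hW hsym hs R
  refine le_antisymm (hle.trans (neg_nonpos.2 (Real.log_nonneg ?_))) hnn
  have hterm : ∀ y, uniformOut W y * (1 - ρ * (infoDensity W y - R))
      ≤ uniformOut W y * Real.exp (-(ρ * (infoDensity W y - R))) := fun y => by
    refine mul_le_mul_of_nonneg_left ?_ (uniformOut_nonneg W y)
    have := Real.add_one_le_exp (-(ρ * (infoDensity W y - R)))
    linarith
  refine le_trans ?_ (Finset.sum_le_sum fun y (_ : y ∈ Finset.univ) => hterm y)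
  have : ∑ y, uniformOut W y * (1 - ρ * (infoDensity W y - R))
      = (1 + ρ * R) * ∑ y, uniformOut W y - ρ * ∑ y, uniformOut W y * infoDensity W y := by
    rw [Finset.mul_sum, Finset.mul_sum, ← Finset.sum_sub_distrib]
    exact Finset.sum_congr rfl fun y _ => by ring
  rw [this, sum_uniformOut hW hs]
  have := mul_le_mul_of_nonneg_left hR hρ.1
  linarith

theorem exists_of_criticalRate_lt (hW : IsChannel W) (hsym : IsSymmetric W)
    (hs : IsSingular W) {R : ℝ} (hR : criticalRate W < R) :
    ∃ R', 0 ≤ R' ∧ R' < R ∧ ∀ r, R' ≤ r →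
      ENNReal.ofReal (randomCodingExponent W r) = spherePackingExponent W r := by
  have hne : {r : ℝ | 0 ≤ r ∧ ∀ R, r ≤ R →
      ENNReal.ofReal (randomCodingExponent W R) = spherePackingExponent W R}.Nonempty := by
    refine ⟨max 0 (∑ y, uniformOut W y * infoDensity W y), le_max_left _ _, fun r hr => ?_⟩
    have hr' := (le_max_right _ _).trans hr
    rw [randomCodingExponent_eq_zero hW hsym hs hr', ENNReal.ofReal_zero,
      spherePackingExponent_eq_zero hW hsym hs ((capacity_le hW hsym hs).trans hr')]
  obtain ⟨R', ⟨h0, h1⟩, h2⟩ := exists_lt_of_csInf_lt hne hR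
  exact ⟨R', h0, h2, h1⟩

theorem isTheta_of_two_sided {u : ℕ → ℝ} {E K₁ K₂ : ℝ} (hK₁ : 0 < K₁)
    (hlow : ∀ N : ℕ, 1 ≤ N → K₁ / Real.sqrt N * Real.exp (-N * E) ≤ u N)
    (hup : ∀ N : ℕ, 1 ≤ N → u N ≤ K₂ / Real.sqrt N * Real.exp (-N * E)) :
    Asymptotics.IsTheta Filter.atTop u
      (fun N : ℕ => 1 / Real.sqrt N * Real.exp (-N * E)) := by
  have hv : ∀ N : ℕ, 0 ≤ 1 / Real.sqrt N * Real.exp (-N * E) := fun N => by positivity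
  have hform : ∀ (K : ℝ) (N : ℕ), K / Real.sqrt N * Real.exp (-N * E)
      = K * (1 / Real.sqrt N * Real.exp (-N * E)) := fun K N => by ring
  have hu : ∀ N : ℕ, 1 ≤ N → 0 ≤ u N := fun N hN =>
    le_trans (by positivity) (hlow N hN)
  constructor
  · refine Asymptotics.IsBigO.of_bound K₂ ?_
    filter_upwards [Filter.eventually_ge_atTop 1] with N hN
    rw [Real.norm_of_nonneg (hu N hN), Real.norm_of_nonneg (hv N), ← hform]
    exact hup N hN
  · refine Asymptotics.IsBigO.of_bound K₁⁻¹ ?_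
    filter_upwards [Filter.eventually_ge_atTop 1] with N hN
    rw [Real.norm_of_nonneg (hu N hN), Real.norm_of_nonneg (hv N), ← div_eq_inv_mul,
      le_div_iff₀ hK₁, mul_comm, ← hform]
    exact hlow N hN

end Exponents

end DMC

theorem theorem2 {X Y : Type*} [Fintype X] [Fintype Y] [Nonempty X]
    (W : X → Y → ℝ) (hW : DMC.IsChannel W)
    (hsymm : DMC.IsSymmetric W) (hsing : DMC.IsSingular W)
    (hcr : DMC.criticalRate W < DMC.capacity W) :
    -- (i) achievability, without feedback, maximal error probability
    (∀ R : ℝ, DMC.criticalRate W < R → R < DMC.capacity W →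
      ∃ K : ℝ, 0 < K ∧ ∀ N : ℕ, 1 ≤ N →
        DMC.minMaxError W N R ≤
          K / Real.sqrt N * Real.exp (-N * DMC.randomCodingExponent W R)) ∧
    -- (ii) converse, even with ideal feedback, average error probability
    (∀ R : ℝ, DMC.rateInfty W < R → R < DMC.capacity W →
      DMC.spherePackingExponent W R ≠ ⊤ ∧
      ∃ K : ℝ, 0 < K ∧ ∀ N : ℕ, 1 ≤ N →
        K / Real.sqrt N * Real.exp (-N * (DMC.spherePackingExponent W R).toReal) ≤
          DMC.minAvgErrorFeedback W N R) ∧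
    -- above the critical rate the two exponents agree and the order of the pre-factor is exact,
    -- with and without feedback
    (∀ R : ℝ, DMC.criticalRate W < R → R < DMC.capacity W →
      (DMC.spherePackingExponent W R).toReal = DMC.randomCodingExponent W R ∧
      Asymptotics.IsTheta Filter.atTop (fun N : ℕ => DMC.minMaxError W N R)
        (fun N : ℕ => 1 / Real.sqrt N * Real.exp (-N * DMC.randomCodingExponent W R)) ∧
      Asymptotics.IsTheta Filter.atTop (fun N : ℕ => DMC.minAvgErrorFeedback W N R)
        (fun N : ℕ => 1 / Real.sqrt N * Real.exp (-N * DMC.randomCodingExponent W R))) := by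

  have hi : ∀ R : ℝ, DMC.criticalRate W < R → R < DMC.capacity W →
      ∃ K : ℝ, 0 < K ∧ ∀ N : ℕ, 1 ≤ N →
        DMC.minMaxError W N R ≤
          K / Real.sqrt N * Real.exp (-N * DMC.randomCodingExponent W R) := by
    intro R hR hRC
    obtain ⟨R', h0, h1, h2⟩ := DMC.exists_of_criticalRate_lt hW hsymm hsing hR
    exact DMC.exists_minMaxError_le hW hsymm hsing h0 h1 hRC (h2 R' le_rfl) (h2 R h1.le)
  refine ⟨hi, fun R hR hRC => ?_, fun R hR hRC => ?_⟩
  · obtain ⟨R', h1, h2⟩ := DMC.exists_ne_top_of_rateInfty_lt hW hsymm hsing hR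
    exact DMC.exists_le_minAvgErrorFeedback hW hsymm hsing h1 hRC h2
  · obtain ⟨R', h0, h1, h2⟩ := DMC.exists_of_criticalRate_lt hW hsymm hsing hR
    have hE : (DMC.spherePackingExponent W R).toReal = DMC.randomCodingExponent W R := by
      rw [← h2 R h1.le, ENNReal.toReal_ofReal
        (DMC.exists_randomCodingExponent_le hW hsymm hsing R).1]
    obtain ⟨-, K₁, hK₁, hlow⟩ := DMC.exists_le_minAvgErrorFeedback hW hsymm hsing h1 hRC
      (h2 R' le_rfl ▸ ENNReal.ofReal_ne_top)
    obtain ⟨K₂, -, hup⟩ := hi R hR hRC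
    rw [hE] at hlow
    have hcomp := fun N => DMC.minAvgErrorFeedback_le_minMaxError hW N R
    exact ⟨hE, DMC.isTheta_of_two_sided hK₁ (fun N hN => (hlow N hN).trans (hcomp N)) hup,
      DMC.isTheta_of_two_sided hK₁ hlow fun N hN => (hcomp N).trans (hup N hN)⟩
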